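/- Let $s\in(0,1]$ and $\lambda\in\mathbb{R}$. Define the kernel on $\mathbb{R}$ $$W(z)=c_{1,s}|z|^{2s-1},\quad c_{1,s}=\frac{s\,2^{-2s}\,\Gamma(\tfrac12-s)}{\pi^{1/2}\,\Gamma(1+s)}\quad\text{if } s\neq\tfrac12,\qquad W(z)=-\frac1\pi\log|z|\quad\text{if } s=\tfrac12,$$ with $W(0)=+\infty$ for $s\le\frac12$. Write $(-\partial_{xx})^{-s}\rho=W*\rho$. Let $\mathcal{P}_2(\mathbb{R})$ be the set of Borel probability measures on $\mathbb{R}$ with finite second moment; a measure with a density is identified with its density. For $\mu,\nu\in\mathcal{P}_2(\mathbb{R})$ let $$\mathcal{E}(\mu)=\frac12\iint W(x-y)\,d\mu(x)\,d\mu(y)+\frac{\lambda}{2}\int x^2\,d\mu(x)\in(-\infty,+\infty],\qquad W_2(\mu,\nu)=\Big(\inf_{\pi}\int_{\mathbb{R}\times\mathbb{R}}|x-y|^2\,d\pi(x,y)\Big)^{1/2},$$ where $\pi$ ranges over the measures on $\mathbb{R}\times\mathbb{R}$ with marginals $\mu$ and $\nu$. For a probability density $\rho$ let $$\mathcal{I}(\rho)=\int_{\mathbb{R}}\rho\,|\partial_x\xi|^2\,dx,\qquad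 \xi=(-\partial_{xx})^{-s}\rho+\frac{\lambda}{2}x^2 .$$ Theorem (HWI inequality in one dimension). Let $\max(1-2s,0)<\alpha\le1$, and let $\rho\in L^1(\mathbb{R})\cap L^\infty(\mathbb{R})\cap C^\alpha(\mathbb{R})$ (that is, $\rho$ is globally $\alpha$-Hölder continuous) be nonnegative with $\int\rho\,dx=1$ and $\int x^2\rho\,dx<\infty$. Let $\rho_\infty\in\mathcal{P}_2(\mathbb{R})$ be a minimum point of $\mathcal{E}$ on $\mathcal{P}_2(\mathbb{R})$. Then the integral defining $(-\partial_{xx})^{-s}\rho(x)$ converges absolutely for every $x$, $\xi$ is differentiable on $\mathbb{R}$, the quantities $\mathcal{E}(\rho)$, $\mathcal{E}(\rho_\infty)$, $\mathcal{I}(\rho)$ and $W_2(\rho,\rho_\infty)$ are finite, and $$\mathcal{E}(\rho)-\mathcal{E}(\rho_\infty)\le\sqrt{\mathcal{I}(\rho)}\;W_2(\rho,\rho_\infty)-\frac{\lambda}{2}W_2^2(\rho,\rho_\infty).$$ If moreover $\lambda>0$, then the Log-Sobolev and the Talagrand inequality hold: $$\mathcal{E}(\rho)-\mathcal{E}(\rho_\infty)\le\frac{1}{2\lambda}\mathcal{I}(\rho),\qquad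 W_2(\rho,\rho_\infty)\le\sqrt{\frac{2}{\lambda}\big(\mathcal{E}(\rho)-\mathcal{E}(\rho_\infty)\big)} .$$ -/

import Mathlib

open MeasureTheory
open scoped NNReal ENNReal

noncomputable section

namespace FracHWI

/-- The one-dimensional Riesz constant
`c_{1,s} = s 2^{-2s} Γ(1/2 - s) / (π^{1/2} Γ(1 + s))`, used for `s ≠ 1/2`.
It is negative for `1/2 < s ≤ 1`. -/
def rieszConst (s : ℝ) : ℝ :=
  s * (2 : ℝ) ^ (-2 * s) * Real.Gamma (1 / 2 - s) / (Real.pi ^ (1 / 2 : ℝ) * Real.Gamma (1 + s))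

/-- The kernel `W` of `(-∂ₓₓ)^{-s}` on the real line, away from the origin:
`c_{1,s} |z|^{2s-1}` if `s ≠ 1/2`, and `-(1/π) log |z|` if `s = 1/2`. -/
def kernel (s z : ℝ) : ℝ :=
  if s = 1 / 2 then -(1 / Real.pi) * Real.log |z| else rieszConst s * |z| ^ (2 * s - 1)

/-- The kernel with its true value at the origin, which is `+∞` for `s ≤ 1/2`
(and `0` for `s > 1/2`). -/
def extKernel (s z : ℝ) : EReal :=
  if z = 0 ∧ s ≤ 1 / 2 then ⊤ else (kernel s z : EReal)

/-- `∬ W(x - y) dμ(x) dμ(y)`, as the integral of the positive part minus the integral of the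
negative part. The latter is finite for every `μ` with finite second moment. -/
def interaction (s : ℝ) (μ : Measure ℝ) : EReal :=
  ((∫⁻ p : ℝ × ℝ, (extKernel s (p.1 - p.2)).toENNReal ∂(μ.prod μ) : ℝ≥0∞) : EReal) -
    ((∫⁻ p : ℝ × ℝ, (-extKernel s (p.1 - p.2)).toENNReal ∂(μ.prod μ) : ℝ≥0∞) : EReal)

/-- The free energy
`𝓔(μ) = 1/2 ∬ W(x - y) dμ(x) dμ(y) + lam/2 ∫ x² dμ(x)` of `μ` with finite second moment. -/
def energy (s lam : ℝ) (μ : Measure ℝ) : EReal :=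
  ((1 / 2 : ℝ) : EReal) * interaction s μ + ((lam / 2 * ∫ x, x ^ 2 ∂μ : ℝ) : EReal)

/-- Borel probability measures on the real line with finite second moment. -/
def P2 : Set (Measure ℝ) :=
  {μ | IsProbabilityMeasure μ ∧ ∫⁻ x, ENNReal.ofReal (x ^ 2) ∂μ < ∞}

/-- `μ` is a minimum point of the energy on `P2`. -/
def IsEnergyMinimizer (s lam : ℝ) (μ : Measure ℝ) : Prop :=
  μ ∈ P2 ∧ IsMinOn (energy s lam) P2 μ

/-- The Wasserstein distance: the square root of the infimum of `∫ |x - y|² dπ(x, y)` over all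
measures `π` on the plane with marginals `μ` and `ν`. -/
def W2 (μ ν : Measure ℝ) : ℝ≥0∞ :=
  (⨅ (π : Measure (ℝ × ℝ)) (_ : π.map Prod.fst = μ ∧ π.map Prod.snd = ν),
    ∫⁻ p, ENNReal.ofReal (|p.1 - p.2| ^ 2) ∂π) ^ (1 / 2 : ℝ)

/-- The measure `ρ(x) dx`. -/
def law (ρ : ℝ → ℝ) : Measure ℝ :=
  volume.withDensity fun x => ENNReal.ofReal (ρ x)

/-- The Riesz potential `(-∂ₓₓ)^{-s} ρ = W ∗ ρ`. -/
def rieszPotential (s : ℝ) (ρ : ℝ → ℝ) (x : ℝ) : ℝ :=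
  ∫ y, kernel s (x - y) * ρ y

/-- The first variation `ξ = (-∂ₓₓ)^{-s} ρ + (lam/2) x²` of the energy. -/
def firstVariation (s lam : ℝ) (ρ : ℝ → ℝ) (x : ℝ) : ℝ :=
  rieszPotential s ρ x + lam / 2 * x ^ 2

/-- The energy dissipation `𝓘(ρ) = ∫ ρ |∂ₓ ξ|² dx`. -/
def dissipation (s lam : ℝ) (ρ : ℝ → ℝ) : ℝ≥0∞ :=
  ∫⁻ x, ENNReal.ofReal (ρ x * |deriv (firstVariation s lam ρ) x| ^ 2)

end FracHWI

end

/-!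
On the line the free energy is `lam`-convex along monotone transport, because every kernel `W` is
convex on `(0, ∞)`: in all cases `W'(z) = -k z ^ (2 s - 2)` there, with one constant `k ≥ 0`
(`slopeConst_nonneg`, `hasDerivAt_kernel`). A monotone coupling `π` of `μ = ρ dx` and `ν` never
reverses the order of two particles, so that for pairs `(x, y)`, `(x', y')` in its support
`W (y - y') ≥ W (x - x') + W' (x - x') ((y - y') - (x - x'))`. Integrating this over `π ⊗ π`, and
using that `W'` is odd, gives the first-order inequality
`𝓔(ν) ≥ 𝓔(μ) + ∫ ξ'(x) (y - x) dπ + lam/2 ∫ (y - x)² dπ` (`first_order_le_realEnergy`). If `π` is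
also optimal for the quadratic cost, the Cauchy-Schwarz inequality turns it into the HWI inequality,
and the Log-Sobolev inequality follows by maximising over the value of the distance. Convexity along
the interpolation `(1 - t) y + t x` (`realEnergy_interpolation_le`), with the minimality of `ν` and
`t → 0`, gives the Talagrand inequality.

The coupling is that of the quantile functions (`exists_monotone_optimal_coupling`). Its optimality
needs no duality: `(x - y)²` is the area of a square, so the transport cost is an integral of the
probabilities `π(X ≤ a, b < Y)` and `π(Y ≤ a, b < X)`, and the quantile coupling minimises each of
them.

The derivative `W'` need not be integrable at the origin. All inequalities are therefore first shown
for `regKernel s ε`, which continues `W` by its tangent on `|z| < ε`, is Lipschitz, is still convex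
in `|z|`, and lies below `W`. The derivatives of the regularised potentials converge uniformly as
`ε → 0`: after symmetrisation the integrand is `O(|z| ^ (2 s - 2 + α))` at the origin, by Hölder
continuity of `ρ`, and `2 s - 2 + α > -1` (`abs_integral_regSlope_sub_le`). The limit is a bounded
derivative of the Riesz potential (`hasDerivAt_rieszPotential`), which also yields the finiteness
of the dissipation.
-/

namespace FracHWI

open Set Filter Topology

/-! ### The kernel and its convex regularisation -/

/-- The constant `k` for which the kernel satisfies `W'(z) = -k z ^ (2 s - 2)` on `(0, ∞)`. -/
noncomputable def slopeConst (s : ℝ) : ℝ :=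
  if s = 1 / 2 then 1 / Real.pi else (1 - 2 * s) * rieszConst s

lemma slopeConst_nonneg {s : ℝ} (hs0 : 0 < s) (hs1 : s ≤ 1) : 0 ≤ slopeConst s := by
  unfold slopeConst
  split_ifs with h
  · positivity
  · have hne : (1 / 2 - s) ≠ 0 := fun h' => h (by linarith)
    have hG := Real.Gamma_add_one hne
    have hpos : 0 < Real.Gamma (1 / 2 - s + 1) := Real.Gamma_pos_of_pos (by linarith)
    have hpos' : 0 < Real.Gamma (1 + s) := Real.Gamma_pos_of_pos (by linarith)
    have : (1 - 2 * s) * rieszConst s = 2 * (s * (2 : ℝ) ^ (-2 * s) * Real.Gamma (1 / 2 - s + 1)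
        / (Real.pi ^ (1 / 2 : ℝ) * Real.Gamma (1 + s))) := by
      rw [hG, rieszConst]; ring
    rw [this]; positivity

lemma kernel_abs (s z : ℝ) : kernel s |z| = kernel s z := by simp [kernel]

lemma measurable_kernel (s : ℝ) : Measurable (kernel s) := by
  unfold kernel
  split_ifs <;> fun_prop

lemma hasDerivAt_kernel (s : ℝ) {r : ℝ} (hr : 0 < r) :
    HasDerivAt (kernel s) (-slopeConst s * r ^ (2 * s - 2)) r := by
  have hev : ∀ᶠ z in 𝓝 r, 0 < z := lt_mem_nhds hr
  by_cases h : s = 1 / 2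
  · have h1 : HasDerivAt (fun z => -(1 / Real.pi) * Real.log z) (-(1 / Real.pi) * r⁻¹) r :=
      (Real.hasDerivAt_log hr.ne').const_mul _
    have h2 : -slopeConst s * r ^ (2 * s - 2) = -(1 / Real.pi) * r⁻¹ := by
      rw [slopeConst, if_pos h, h, ← Real.rpow_neg_one]; norm_num
    rw [h2]
    refine h1.congr_of_eventuallyEq ?_
    filter_upwards [hev] with z hz
    rw [kernel, if_pos h, abs_of_pos hz]
  · have h1 : HasDerivAt (fun z => rieszConst s * z ^ (2 * s - 1))
        (rieszConst s * ((2 * s - 1) * r ^ (2 * s - 1 - 1))) r :=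
      (Real.hasDerivAt_rpow_const (Or.inl hr.ne')).const_mul _
    have h2 : -slopeConst s * r ^ (2 * s - 2) =
        rieszConst s * ((2 * s - 1) * r ^ (2 * s - 1 - 1)) := by
      rw [slopeConst, if_neg h, show 2 * s - 1 - 1 = 2 * s - 2 by ring]; ring
    rw [h2]
    refine h1.congr_of_eventuallyEq ?_
    filter_upwards [hev] with z hz
    rw [kernel, if_neg h, abs_of_pos hz]

/-- The power `u ^ (2 s - 2)`, frozen at its value at `ε` for `u ≤ ε`. -/
noncomputable def cutPow (s ε u : ℝ) : ℝ := max u ε ^ (2 * s - 2)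

/-- The regularised kernel, for `0 < ε ≤ 1`: it agrees with `W` at `|z| ≥ ε`, and continues `W` by
its tangent for `|z| < ε`. It is defined through the primitive of `cutPow`. -/
noncomputable def regKernel (s ε z : ℝ) : ℝ :=
  kernel s 1 - slopeConst s * ∫ u in (1 : ℝ)..|z|, cutPow s ε u

/-- The derivative of `regKernel s ε` away from the origin, with value `0` at the origin. For
`ε = 0` it is the derivative of `W` itself. -/
noncomputable def regSlope (s ε z : ℝ) : ℝ :=
  -slopeConst s * cutPow s ε |z| * (SignType.sign z : ℝ)

lemma measurable_sign : Measurable fun z : ℝ => ((SignType.sign z : SignType) : ℝ) := by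
  have : (fun z : ℝ => ((SignType.sign z : SignType) : ℝ)) =
      fun z => if 0 < z then 1 else if z < 0 then -1 else 0 := by
    ext z; rw [sign_apply]; split_ifs <;> simp
  rw [this]
  exact Measurable.ite measurableSet_Ioi measurable_const
    (Measurable.ite measurableSet_Iio measurable_const measurable_const)

lemma abs_sign_le_one (z : ℝ) : |((SignType.sign z : SignType) : ℝ)| ≤ 1 := by
  rcases lt_trichotomy z 0 with h | h | h <;> simp [h]

lemma cutPow_nonneg (s : ℝ) {ε : ℝ} (hε : 0 ≤ ε) (u : ℝ) : 0 ≤ cutPow s ε u :=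
  Real.rpow_nonneg (le_max_of_le_right hε) _

lemma cutPow_le {s ε : ℝ} (hs1 : s ≤ 1) (hε : 0 < ε) (u : ℝ) : cutPow s ε u ≤ ε ^ (2 * s - 2) :=
  Real.rpow_le_rpow_of_nonpos hε (le_max_right _ _) (by linarith)

lemma antitone_cutPow {s ε : ℝ} (hs1 : s ≤ 1) (hε : 0 < ε) : Antitone (cutPow s ε) :=
  fun _ _ h => Real.rpow_le_rpow_of_nonpos (lt_max_of_lt_right hε) (max_le_max_right _ h)
    (by linarith)

lemma cutPow_le_cutPow {s δ ε : ℝ} (hs1 : s ≤ 1) (hδ : 0 < δ) (h : δ ≤ ε) (u : ℝ) :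
    cutPow s ε u ≤ cutPow s δ u :=
  Real.rpow_le_rpow_of_nonpos (lt_max_of_lt_right hδ) (max_le_max_left _ h) (by linarith)

lemma continuous_cutPow (s : ℝ) {ε : ℝ} (hε : 0 < ε) : Continuous (cutPow s ε) := by
  unfold cutPow
  exact (continuous_id.max continuous_const).rpow_const
    fun u => Or.inl (lt_max_of_lt_right hε).ne'

lemma measurable_regSlope (s ε : ℝ) : Measurable (regSlope s ε) := by
  unfold regSlope cutPow
  exact (Measurable.const_mul (by fun_prop) _).mul measurable_sign

lemma regSlope_neg (s ε z : ℝ) : regSlope s ε (-z) = -regSlope s ε z := by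
  simp [regSlope, Left.sign_neg]

lemma abs_regSlope_le {s ε : ℝ} (hs0 : 0 < s) (hs1 : s ≤ 1) (hε : 0 ≤ ε) (z : ℝ) :
    |regSlope s ε z| ≤ slopeConst s * cutPow s ε |z| := by
  rw [regSlope, abs_mul, abs_mul, abs_neg, abs_of_nonneg (slopeConst_nonneg hs0 hs1),
    abs_of_nonneg (cutPow_nonneg s hε _)]
  exact mul_le_of_le_one_right
    (mul_nonneg (slopeConst_nonneg hs0 hs1) (cutPow_nonneg s hε _)) (abs_sign_le_one z)

lemma abs_regSlope_le_const {s ε : ℝ} (hs0 : 0 < s) (hs1 : s ≤ 1) (hε : 0 < ε) (z : ℝ) :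
    |regSlope s ε z| ≤ slopeConst s * ε ^ (2 * s - 2) :=
  (abs_regSlope_le hs0 hs1 hε.le z).trans
    (mul_le_mul_of_nonneg_left (cutPow_le hs1 hε _) (slopeConst_nonneg hs0 hs1))

lemma regKernel_sub_regKernel (s : ℝ) {ε : ℝ} (hε : 0 < ε) (x y : ℝ) :
    regKernel s ε y - regKernel s ε x = -(slopeConst s * ∫ u in |x|..|y|, cutPow s ε u) := by
  have hi : ∀ a b : ℝ, IntervalIntegrable (cutPow s ε) volume a b :=
    fun a b => (continuous_cutPow s hε).intervalIntegrable a b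
  rw [regKernel, regKernel,
    ← intervalIntegral.integral_add_adjacent_intervals (hi 1 |x|) (hi |x| |y|)]
  ring

/-- The regularised kernel is a convex function of `|z|`. -/
lemma regKernel_tangent_le {s ε : ℝ} (hs0 : 0 < s) (hs1 : s ≤ 1) (hε : 0 < ε) {x y : ℝ}
    (hx : x ≠ 0) (hxy : 0 ≤ x * y) :
    regKernel s ε x + regSlope s ε x * (y - x) ≤ regKernel s ε y := by
  have hsign : (SignType.sign x : ℝ) * (y - x) = |y| - |x| := by
    rcases hx.lt_or_gt with h | h
    · have hy : y ≤ 0 := by nlinarith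
      simp [h, abs_of_neg h, abs_of_nonpos hy]; ring
    · have hy : 0 ≤ y := by nlinarith
      simp [h, abs_of_pos h, abs_of_nonneg hy]
  have hint : ∫ u in |x|..|y|, cutPow s ε u ≤ cutPow s ε |x| * (|y| - |x|) := by
    have hi : ∀ a b : ℝ, IntervalIntegrable (cutPow s ε) volume a b :=
      fun a b => (continuous_cutPow s hε).intervalIntegrable a b
    have hc : ∀ a b : ℝ, IntervalIntegrable (fun _ : ℝ => cutPow s ε |x|) volume a b :=
      fun a b => continuous_const.intervalIntegrable a b
    have hconst : ∫ _ in |x|..|y|, cutPow s ε |x| = cutPow s ε |x| * (|y| - |x|) := by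
      rw [intervalIntegral.integral_const, smul_eq_mul, mul_comm]
    rw [← hconst]
    rcases le_total |x| |y| with h | h
    · exact intervalIntegral.integral_mono_on h (hi _ _) (hc _ _)
        fun u hu => antitone_cutPow hs1 hε hu.1
    · rw [intervalIntegral.integral_symm |y| |x|, intervalIntegral.integral_symm |y| |x|]
      exact neg_le_neg (intervalIntegral.integral_mono_on h (hc _ _) (hi _ _)
        fun u hu => antitone_cutPow hs1 hε hu.2)
  have h1 := regKernel_sub_regKernel s hε x y
  have h2 := mul_le_mul_of_nonneg_left hint (slopeConst_nonneg hs0 hs1)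
  have h3 : regSlope s ε x * (y - x) =
      -(slopeConst s * (cutPow s ε |x| * (|y| - |x|))) := by
    rw [← hsign, regSlope]; ring
  linarith

lemma regKernel_convex_comb_le {s ε : ℝ} (hs0 : 0 < s) (hs1 : s ≤ 1) (hε : 0 < ε) {x y t : ℝ}
    (hx : x ≠ 0) (hxy : 0 ≤ x * y) (ht0 : 0 < t) (ht1 : t ≤ 1) :
    regKernel s ε ((1 - t) * y + t * x) ≤ (1 - t) * regKernel s ε y + t * regKernel s ε x := by
  set c := (1 - t) * y + t * x with hc
  have ht : 0 ≤ 1 - t := by linarith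
  have hxx : 0 < x * x := mul_self_pos.2 hx
  have hxc : 0 < c * x := by
    have : c * x = (1 - t) * (x * y) + t * (x * x) := by rw [hc]; ring
    rw [this]; positivity
  have hyc : 0 ≤ c * y := by
    have : c * y = (1 - t) * (y * y) + t * (x * y) := by rw [hc]; ring
    rw [this]
    have := mul_self_nonneg y
    positivity
  have hc0 : c ≠ 0 := left_ne_zero_of_mul hxc.ne'
  have h1 := mul_le_mul_of_nonneg_left (regKernel_tangent_le hs0 hs1 hε hc0 hyc) ht
  have h2 := mul_le_mul_of_nonneg_left (regKernel_tangent_le hs0 hs1 hε hc0 hxc.le) ht0.le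
  have h3 : (1 - t) * (regSlope s ε c * (y - c)) + t * (regSlope s ε c * (x - c)) = 0 := by
    rw [hc]; ring
  linarith

lemma abs_regKernel_sub_le {s ε : ℝ} (hs0 : 0 < s) (hs1 : s ≤ 1) (hε : 0 < ε) (x y : ℝ) :
    |regKernel s ε y - regKernel s ε x| ≤ slopeConst s * ε ^ (2 * s - 2) * |y - x| := by
  have hk := slopeConst_nonneg hs0 hs1
  have hb : |∫ u in |x|..|y|, cutPow s ε u| ≤ ε ^ (2 * s - 2) * |(|y| - |x|)| := by
    rw [← Real.norm_eq_abs]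
    refine intervalIntegral.norm_integral_le_of_norm_le_const fun u _ => ?_
    rw [Real.norm_eq_abs, abs_of_nonneg (cutPow_nonneg s hε.le u)]
    exact cutPow_le hs1 hε u
  rw [regKernel_sub_regKernel s hε, abs_neg, abs_mul, abs_of_nonneg hk, mul_assoc]
  refine mul_le_mul_of_nonneg_left (hb.trans ?_) hk
  exact mul_le_mul_of_nonneg_left (abs_abs_sub_abs_le_abs_sub y x) (Real.rpow_nonneg hε.le _)

lemma continuous_regKernel {s ε : ℝ} (hs0 : 0 < s) (hs1 : s ≤ 1) (hε : 0 < ε) :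
    Continuous (regKernel s ε) := by
  have : LipschitzWith (Real.toNNReal (slopeConst s * ε ^ (2 * s - 2))) (regKernel s ε) :=
    LipschitzWith.of_dist_le_mul fun x y => by
      rw [Real.dist_eq, Real.dist_eq, Real.coe_toNNReal _
        (mul_nonneg (slopeConst_nonneg hs0 hs1) (Real.rpow_nonneg hε.le _))]
      exact abs_regKernel_sub_le hs0 hs1 hε y x
  exact this.continuous

lemma hasDerivAt_regKernel (s : ℝ) {ε z : ℝ} (hε : 0 < ε) (hz : z ≠ 0) :
    HasDerivAt (regKernel s ε) (regSlope s ε z) z := by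
  have hc := continuous_cutPow s hε
  have h1 : HasDerivAt (fun r => ∫ u in (1 : ℝ)..r, cutPow s ε u) (cutPow s ε |z|) |z| :=
    intervalIntegral.integral_hasDerivAt_right (hc.intervalIntegrable _ _)
      hc.aestronglyMeasurable.stronglyMeasurableAtFilter hc.continuousAt
  have h2 := ((h1.comp z (hasDerivAt_abs hz)).const_mul (slopeConst s)).const_sub (kernel s 1)
  have h3 : regSlope s ε z = -(slopeConst s * (cutPow s ε |z| * (SignType.sign z : ℝ))) := by
    rw [regSlope]; ring
  rw [h3]
  exact h2

/-- The fundamental theorem of calculus for `W` on `(0, ∞)`. -/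
lemma kernel_sub_kernel_one (s : ℝ) {z : ℝ} (hz : z ≠ 0) :
    kernel s z = kernel s 1 - slopeConst s * ∫ u in (1 : ℝ)..|z|, u ^ (2 * s - 2) := by
  have hpos : ∀ u ∈ uIcc (1 : ℝ) |z|, 0 < u := fun u hu =>
    lt_of_lt_of_le (lt_min one_pos (abs_pos.2 hz)) hu.1
  have hi : IntervalIntegrable (fun u => -slopeConst s * u ^ (2 * s - 2)) volume 1 |z| := by
    refine ContinuousOn.intervalIntegrable (continuousOn_const.mul ?_)
    exact continuousOn_id.rpow_const fun u hu => Or.inl (hpos u hu).ne'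
  have := intervalIntegral.integral_eq_sub_of_hasDerivAt
    (fun u hu => hasDerivAt_kernel s (hpos u hu)) hi
  rw [intervalIntegral.integral_const_mul, kernel_abs] at this
  linarith

lemma regKernel_eq_kernel (s : ℝ) {ε z : ℝ} (hε : 0 < ε) (hε1 : ε ≤ 1) (hz : ε ≤ |z|) :
    regKernel s ε z = kernel s z := by
  have hz0 : z ≠ 0 := abs_pos.1 (hε.trans_le hz)
  rw [kernel_sub_kernel_one s hz0, regKernel]
  congr 2
  refine intervalIntegral.integral_congr fun u hu => ?_
  have : ε ≤ u := (le_min hε1 hz).trans hu.1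
  simp only [cutPow, max_eq_left this]

lemma regKernel_anti {s δ ε : ℝ} (hs0 : 0 < s) (hs1 : s ≤ 1) (hδ : 0 < δ) (h : δ ≤ ε)
    (hε1 : ε ≤ 1) (z : ℝ) : regKernel s ε z ≤ regKernel s δ z := by
  have hε : 0 < ε := hδ.trans_le h
  by_cases hz : ε ≤ |z|
  · rw [regKernel_eq_kernel s hε hε1 hz, regKernel_eq_kernel s hδ (h.trans hε1) (h.trans hz)]
  · push Not at hz
    have h1 : ∫ u in |z|..1, cutPow s ε u ≤ ∫ u in |z|..1, cutPow s δ u :=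
      intervalIntegral.integral_mono (hz.le.trans hε1)
        ((continuous_cutPow s hε).intervalIntegrable _ _)
        ((continuous_cutPow s hδ).intervalIntegrable _ _) (cutPow_le_cutPow hs1 hδ h)
    rw [regKernel, regKernel, intervalIntegral.integral_symm |z| 1,
      intervalIntegral.integral_symm |z| 1]
    have := mul_le_mul_of_nonneg_left h1 (slopeConst_nonneg hs0 hs1)
    linarith

lemma regKernel_le_kernel {s ε z : ℝ} (hs0 : 0 < s) (hs1 : s ≤ 1) (hε : 0 < ε) (hε1 : ε ≤ 1)
    (hz : z = 0 → 1 / 2 < s) : regKernel s ε z ≤ kernel s z := by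
  have main : ∀ w : ℝ, w ≠ 0 → regKernel s ε w ≤ kernel s w := fun w hw => by
    have hw' : 0 < min ε |w| := lt_min hε (abs_pos.2 hw)
    exact (regKernel_anti hs0 hs1 hw' (min_le_left _ _) hε1 w).trans_eq
      (regKernel_eq_kernel s hw' ((min_le_left _ _).trans hε1) (min_le_right _ _))
  by_cases h : z = 0
  · -- for `s > 1/2` the kernel is continuous at the origin
    have hs := hz h
    subst h
    have hcont : Continuous (kernel s) := by
      unfold kernel
      simp only [if_neg hs.ne']
      exact continuous_const.mul (continuous_abs.rpow_const fun _ => Or.inr (by linarith))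
    have h1 : Tendsto (regKernel s ε) (𝓝[≠] 0) (𝓝 (regKernel s ε 0)) :=
      (continuous_regKernel hs0 hs1 hε).continuousAt.tendsto.mono_left nhdsWithin_le_nhds
    have h2 : Tendsto (kernel s) (𝓝[≠] 0) (𝓝 (kernel s 0)) :=
      hcont.continuousAt.tendsto.mono_left nhdsWithin_le_nhds
    refine le_of_tendsto_of_tendsto h1 h2 ?_
    filter_upwards [self_mem_nhdsWithin] with w hw using main w hw
  · exact main z h

/-- `W` is convex along segments that start at `y` and end at `x ≠ 0` without changing sign: at their
other points `W` coincides with a regularisation at a small enough scale. -/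
lemma kernel_convex_comb_le {s : ℝ} (hs0 : 0 < s) (hs1 : s ≤ 1) {x y t : ℝ}
    (hx : x ≠ 0) (hy : y = 0 → 1 / 2 < s) (hxy : 0 ≤ x * y) (ht0 : 0 < t) (ht1 : t ≤ 1) :
    kernel s ((1 - t) * y + t * x) ≤ (1 - t) * kernel s y + t * kernel s x := by
  set c := (1 - t) * y + t * x with hc
  have ht : 0 ≤ 1 - t := by linarith
  have hxc : 0 < c * x := by
    have : c * x = (1 - t) * (x * y) + t * (x * x) := by rw [hc]; ring
    rw [this]
    have := mul_self_pos.2 hx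
    positivity
  have hc0 : 0 < |c| := abs_pos.2 (left_ne_zero_of_mul hxc.ne')
  set ε := min 1 |c|
  have hε : 0 < ε := lt_min one_pos hc0
  have hε1 : ε ≤ 1 := min_le_left _ _
  rw [← regKernel_eq_kernel s hε hε1 (min_le_right _ _)]
  refine (regKernel_convex_comb_le hs0 hs1 hε hx hxy ht0 ht1).trans ?_
  exact add_le_add
    (mul_le_mul_of_nonneg_left (regKernel_le_kernel hs0 hs1 hε hε1 hy) ht)
    (mul_le_mul_of_nonneg_left (regKernel_le_kernel hs0 hs1 hε hε1 fun h => absurd h hx) ht0.le)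

lemma abs_regKernel_le {s ε : ℝ} (hs0 : 0 < s) (hs1 : s ≤ 1) (hε : 0 < ε) :
    ∃ C : ℝ, 0 ≤ C ∧ ∀ z, |regKernel s ε z| ≤ C * (1 + |z|) := by
  refine ⟨|regKernel s ε 0| + slopeConst s * ε ^ (2 * s - 2),
    add_nonneg (abs_nonneg _) (mul_nonneg (slopeConst_nonneg hs0 hs1) (Real.rpow_nonneg hε.le _)),
    fun z => ?_⟩
  have h := abs_regKernel_sub_le hs0 hs1 hε 0 z
  have hk : 0 ≤ slopeConst s * ε ^ (2 * s - 2) :=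
    mul_nonneg (slopeConst_nonneg hs0 hs1) (Real.rpow_nonneg hε.le _)
  have h2 : |regKernel s ε z| ≤ |regKernel s ε 0| + |regKernel s ε z - regKernel s ε 0| := by
    simpa using abs_add_le (regKernel s ε 0) (regKernel s ε z - regKernel s ε 0)
  rw [sub_zero] at h
  nlinarith [abs_nonneg z, abs_nonneg (regKernel s ε 0)]

lemma intervalIntegrable_abs_rpow {r : ℝ} (hr : -1 < r) :
    IntervalIntegrable (fun z : ℝ => |z| ^ r) volume (-1) 1 := by
  have h1 : IntervalIntegrable (fun z : ℝ => |z| ^ r) volume 0 1 := by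
    refine (intervalIntegral.intervalIntegrable_rpow' hr).congr fun z hz => ?_
    rw [uIoc_of_le zero_le_one] at hz
    simp only [abs_of_pos hz.1]
  have h2 : IntervalIntegrable (fun z : ℝ => |z| ^ r) volume (-0) (-1) := by
    have := (IntervalIntegrable.iff_comp_neg (f := fun z : ℝ => |z| ^ r)
      (a := 0) (b := 1)).1 h1
    simpa using this
  rw [neg_zero] at h2
  exact h2.symm.trans h1

/-- `W` exceeds its regularisation at scale `1` by an integrable function. -/
lemma integrable_kernel_sub_regKernel {s : ℝ} (hs0 : 0 < s) (hs1 : s ≤ 1) :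
    Integrable fun z => kernel s z - regKernel s 1 z := by
  have hI : IntervalIntegrable (kernel s) volume (-1) 1 := by
    unfold kernel
    split_ifs with h
    · simp only [Real.log_abs]
      exact intervalIntegral.intervalIntegrable_log'.const_mul _
    · exact (intervalIntegrable_abs_rpow (by linarith)).const_mul _
  have hR : IntervalIntegrable (regKernel s 1) volume (-1) 1 :=
    (continuous_regKernel hs0 hs1 one_pos).intervalIntegrable _ _
  have hD : IntegrableOn (fun z => kernel s z - regKernel s 1 z) (Ioc (-1) 1) :=
    (intervalIntegrable_iff_integrableOn_Ioc_of_le (by norm_num)).1 (hI.sub hR)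
  refine (integrableOn_iff_integrable_of_support_subset fun z hz => ?_).1 hD
  by_contra hz'
  refine hz ?_
  have : 1 ≤ |z| := by
    by_contra hlt
    push Not at hlt
    exact hz' ⟨(abs_lt.1 hlt).1, (abs_lt.1 hlt).2.le⟩
  simp only [regKernel_eq_kernel s one_pos le_rfl this, sub_self]

/-! ### Optimality of the quantile coupling -/

open ProbabilityTheory in
/-- The quantile function of a probability measure on the real line: the left-continuous inverse of
the distribution function on `(0, 1)`, extended by `0`. -/
noncomputable def quantile (μ : Measure ℝ) (t : ℝ) : ℝ :=
  open Classical in if t ∈ Ioo (0 : ℝ) 1 then sInf {x | t ≤ cdf μ x} else 0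

open ProbabilityTheory in
lemma quantile_le_iff (μ : Measure ℝ) {t : ℝ} (ht : t ∈ Ioo (0 : ℝ) 1) (x : ℝ) :
    quantile μ t ≤ x ↔ t ≤ cdf μ x := by
  rw [quantile, if_pos ht]
  have hne : {x | t ≤ cdf μ x}.Nonempty := by
    obtain ⟨y, hy⟩ := ((tendsto_cdf_atTop μ).eventually (lt_mem_nhds ht.2)).exists
    exact ⟨y, hy.le⟩
  have hbdd : BddBelow {x | t ≤ cdf μ x} := by
    obtain ⟨y, hy⟩ := ((tendsto_cdf_atBot μ).eventually (gt_mem_nhds ht.1)).exists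
    refine ⟨y, fun z hz => ?_⟩
    by_contra hlt
    push Not at hlt
    exact absurd (hz.trans (monotone_cdf μ hlt.le)) (not_le.2 hy)
  refine ⟨fun h => ?_, fun h => csInf_le hbdd h⟩
  refine le_trans ?_ (monotone_cdf μ h)
  -- the infimum is attained since the distribution function is right-continuous
  have hlim := ((cdf μ).right_continuous (sInf {x | t ≤ cdf μ x})).tendsto.mono_left
    (nhdsWithin_mono _ Ioi_subset_Ici_self)
  refine ge_of_tendsto hlim ?_
  filter_upwards [self_mem_nhdsWithin] with y hy
  obtain ⟨z, hz, hzy⟩ := exists_lt_of_csInf_lt hne hy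
  exact le_trans hz (monotone_cdf μ hzy.le)

lemma measurable_quantile (μ : Measure ℝ) : Measurable (quantile μ) := by
  refine measurable_of_Iic fun x => ?_
  have : quantile μ ⁻¹' Iic x = (Ioo 0 1 ∩ Iic (ProbabilityTheory.cdf μ x)) ∪
      ((Ioo 0 1)ᶜ ∩ {_t | 0 ≤ x}) := by
    ext t
    by_cases ht : t ∈ Ioo (0 : ℝ) 1
    · have := quantile_le_iff μ ht x
      simp only [mem_preimage, mem_Iic, this]
      simp [ht.1, ht.2]
    · have h0 : quantile μ t = 0 := by rw [quantile, if_neg ht]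
      simp only [mem_preimage, mem_Iic, h0, mem_union, mem_inter_iff, ht, false_and, false_or,
        mem_compl_iff, not_false_eq_true, true_and, mem_ofPred_eq]
  rw [this]
  exact (measurableSet_Ioo.inter measurableSet_Iic).union
    (measurableSet_Ioo.compl.inter (MeasurableSet.const _))

lemma quantile_mono (μ : Measure ℝ) {t u : ℝ} (ht : t ∈ Ioo (0 : ℝ) 1) (hu : u ∈ Ioo (0 : ℝ) 1)
    (h : t ≤ u) : quantile μ t ≤ quantile μ u :=
  (quantile_le_iff μ ht _).2 (h.trans ((quantile_le_iff μ hu _).1 le_rfl))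

/-- The uniform distribution on `(0, 1)`. -/
noncomputable def unif : Measure ℝ := volume.restrict (Ioo 0 1)

instance : IsProbabilityMeasure unif := ⟨by simp [unif]⟩

lemma map_quantile (μ : Measure ℝ) [IsProbabilityMeasure μ] : unif.map (quantile μ) = μ := by
  have : IsProbabilityMeasure (unif.map (quantile μ)) :=
    Measure.isProbabilityMeasure_map (measurable_quantile μ).aemeasurable
  refine Measure.ext_of_Iic _ _ fun x => ?_
  rw [Measure.map_apply (measurable_quantile μ) measurableSet_Iic, unif,
    Measure.restrict_apply (measurable_quantile μ measurableSet_Iic),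
    ← ProbabilityTheory.ofReal_cdf μ x]
  set c := ProbabilityTheory.cdf μ x
  have hc1 : c ≤ 1 := ProbabilityTheory.cdf_le_one μ x
  apply le_antisymm
  · calc _ ≤ volume (Ioc 0 c) :=
        measure_mono fun t ht => ⟨ht.2.1, (quantile_le_iff μ ht.2 x).1 ht.1⟩
      _ = _ := by simp
  · calc ENNReal.ofReal c = volume (Ioo 0 c) := by simp
      _ ≤ _ := by
        refine measure_mono fun t ht => ?_
        have ht' : t ∈ Ioo (0 : ℝ) 1 := ⟨ht.1, ht.2.trans_le hc1⟩
        exact ⟨(quantile_le_iff μ ht' x).2 ht.2.le, ht'⟩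

lemma measurableSet_le_and_lt {Ω : Type*} [MeasurableSpace Ω] {f g f' g' : Ω → ℝ}
    (hf : Measurable f) (hg : Measurable g) (hf' : Measurable f') (hg' : Measurable g') :
    MeasurableSet {x | f x ≤ g x ∧ f' x < g' x} := by
  rw [Set.ofPred_and]
  exact (measurableSet_le hf hg).inter (measurableSet_lt hf' hg')

/-- The quadratic transport cost as an integral of `π(X ≤ a, b < Y)` and `π(Y ≤ a, b < X)`. It
holds because `(x - y)²` is the area of the square with side `[x, y)`. -/
lemma lintegral_sq_eq (π : Measure (ℝ × ℝ)) [SFinite π] :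
    ∫⁻ p, ENNReal.ofReal (|p.1 - p.2| ^ 2) ∂π =
      (∫⁻ w : ℝ × ℝ, π {p | p.1 ≤ min w.1 w.2 ∧ max w.1 w.2 < p.2}) +
        ∫⁻ w : ℝ × ℝ, π {p | p.2 ≤ min w.1 w.2 ∧ max w.1 w.2 < p.1} := by
  have hA : MeasurableSet {q : (ℝ × ℝ) × (ℝ × ℝ) |
      q.1.1 ≤ min q.2.1 q.2.2 ∧ max q.2.1 q.2.2 < q.1.2} :=
    measurableSet_le_and_lt (by fun_prop) (by fun_prop) (by fun_prop) (by fun_prop)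
  have hB : MeasurableSet {q : (ℝ × ℝ) × (ℝ × ℝ) |
      q.1.2 ≤ min q.2.1 q.2.2 ∧ max q.2.1 q.2.2 < q.1.1} :=
    measurableSet_le_and_lt (by fun_prop) (by fun_prop) (by fun_prop) (by fun_prop)
  have key : ∀ x y : ℝ, volume {w : ℝ × ℝ | x ≤ min w.1 w.2 ∧ max w.1 w.2 < y} =
      ENNReal.ofReal (y - x) * ENNReal.ofReal (y - x) := by
    intro x y
    have : {w : ℝ × ℝ | x ≤ min w.1 w.2 ∧ max w.1 w.2 < y} = Ico x y ×ˢ Ico x y := by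
      ext w; simp only [mem_ofPred_eq, le_min_iff, max_lt_iff, mem_prod, mem_Ico]; tauto
    rw [this, Measure.volume_eq_prod, Measure.prod_prod, Real.volume_Ico]
  have h1 := Measure.prod_apply (μ := π) (ν := (volume : Measure (ℝ × ℝ))) hA
  have h2 := Measure.prod_apply (μ := π) (ν := (volume : Measure (ℝ × ℝ))) hB
  rw [Measure.prod_apply_symm hA] at h1
  rw [Measure.prod_apply_symm hB] at h2
  simp only [preimage_ofPred_eq] at h1 h2
  rw [h1, h2, ← lintegral_add_left]
  · refine lintegral_congr fun p => ?_
    rw [key, key]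
    rcases le_total p.1 p.2 with h | h
    · rw [ENNReal.ofReal_of_nonpos (sub_nonpos.2 h), mul_zero, add_zero,
        ← ENNReal.ofReal_mul (sub_nonneg.2 h), abs_sub_comm, abs_of_nonneg (sub_nonneg.2 h), sq]
    · rw [ENNReal.ofReal_of_nonpos (sub_nonpos.2 h), mul_zero, zero_add,
        ← ENNReal.ofReal_mul (sub_nonneg.2 h), abs_of_nonneg (sub_nonneg.2 h), sq]
  · simp only [key]; fun_prop

/-- For the quantile coupling `P(X ≤ a, b < Y)` is at most `P(X ≤ a) - P(Y ≤ b)`, which is a lower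
bound for every coupling. -/
lemma unif_quantile_le_sub (μ ν : Measure ℝ) [IsProbabilityMeasure μ] [IsProbabilityMeasure ν]
    (a b : ℝ) :
    unif {t | quantile μ t ≤ a ∧ b < quantile ν t} ≤ μ (Iic a) - ν (Iic b) := by
  have hm : MeasurableSet {t | quantile μ t ≤ a ∧ b < quantile ν t} :=
    measurableSet_le_and_lt (measurable_quantile μ) measurable_const measurable_const
      (measurable_quantile ν)
  rw [unif, Measure.restrict_apply hm, ← ProbabilityTheory.ofReal_cdf μ a,
    ← ProbabilityTheory.ofReal_cdf ν b, ← ENNReal.ofReal_sub _ (ProbabilityTheory.cdf_nonneg ν b),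
    ← Real.volume_Ioc]
  refine measure_mono fun t ht => ⟨?_, (quantile_le_iff μ ht.2 a).1 ht.1.1⟩
  by_contra h
  push Not at h
  exact absurd ((quantile_le_iff ν ht.2 b).2 h) (not_le.2 ht.1.2)

/-- The quantile coupling of two probability measures on the line is monotone, and optimal for the
quadratic cost. -/
theorem exists_monotone_optimal_coupling (μ ν : Measure ℝ) [IsProbabilityMeasure μ]
    [IsProbabilityMeasure ν] :
    ∃ π : Measure (ℝ × ℝ), IsProbabilityMeasure π ∧ π.map Prod.fst = μ ∧ π.map Prod.snd = ν ∧
      (∀ᵐ q ∂π.prod π, 0 ≤ (q.1.1 - q.2.1) * (q.1.2 - q.2.2)) ∧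
      W2 μ ν = (∫⁻ p, ENNReal.ofReal (|p.1 - p.2| ^ 2) ∂π) ^ (1 / 2 : ℝ) := by
  have hQ : Measurable fun t => (quantile μ t, quantile ν t) :=
    (measurable_quantile μ).prodMk (measurable_quantile ν)
  set π := unif.map fun t => (quantile μ t, quantile ν t) with hπ
  have hprob : IsProbabilityMeasure π := Measure.isProbabilityMeasure_map hQ.aemeasurable
  have hfst : π.map Prod.fst = μ := by
    rw [hπ, Measure.map_map measurable_fst hQ]; exact map_quantile μ
  have hsnd : π.map Prod.snd = ν := by
    rw [hπ, Measure.map_map measurable_snd hQ]; exact map_quantile ν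
  refine ⟨π, hprob, hfst, hsnd, ?_, ?_⟩
  · rw [hπ, Measure.map_prod_map _ _ hQ hQ]
    have hm : MeasurableSet {q : (ℝ × ℝ) × (ℝ × ℝ) | 0 ≤ (q.1.1 - q.2.1) * (q.1.2 - q.2.2)} :=
      measurableSet_le measurable_const (by fun_prop)
    rw [ae_map_iff (by fun_prop) hm]
    have h0 : ∀ᵐ t ∂unif, t ∈ Ioo (0 : ℝ) 1 := ae_restrict_mem measurableSet_Ioo
    have h1 := (Measure.quasiMeasurePreserving_fst (μ := unif) (ν := unif)).ae h0
    have h2 := (Measure.quasiMeasurePreserving_snd (μ := unif) (ν := unif)).ae h0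
    filter_upwards [h1, h2] with z hz1 hz2
    simp only [Prod.map_fst, Prod.map_snd]
    rcases le_total z.1 z.2 with h | h
    · exact mul_nonneg_of_nonpos_of_nonpos (sub_nonpos.2 (quantile_mono μ hz1 hz2 h))
        (sub_nonpos.2 (quantile_mono ν hz1 hz2 h))
    · exact mul_nonneg (sub_nonneg.2 (quantile_mono μ hz2 hz1 h))
        (sub_nonneg.2 (quantile_mono ν hz2 hz1 h))
  · rw [W2]
    congr 1
    refine le_antisymm (iInf₂_le π ⟨hfst, hsnd⟩) (le_iInf₂ fun π' h' => ?_)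
    have : IsProbabilityMeasure π' := by
      refine ⟨?_⟩
      rw [← preimage_univ (f := Prod.fst), ← Measure.map_apply measurable_fst MeasurableSet.univ,
        h'.1, measure_univ]
    have e1 : ∀ a, π' {p | p.1 ≤ a} = μ (Iic a) := fun a => by
      rw [← h'.1, Measure.map_apply measurable_fst measurableSet_Iic]; rfl
    have e2 : ∀ a, π' {p | p.2 ≤ a} = ν (Iic a) := fun a => by
      rw [← h'.2, Measure.map_apply measurable_snd measurableSet_Iic]; rfl
    rw [lintegral_sq_eq, lintegral_sq_eq]
    refine add_le_add (lintegral_mono fun w => ?_) (lintegral_mono fun w => ?_)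
    · rw [hπ, Measure.map_apply hQ (measurableSet_le_and_lt (by fun_prop) (by fun_prop)
        (by fun_prop) (by fun_prop))]
      refine (unif_quantile_le_sub μ ν _ _).trans ?_
      rw [← e1, ← e2]
      exact le_measure_sdiff.trans (measure_mono fun p hp => ⟨hp.1, not_le.1 hp.2⟩)
    · rw [hπ, Measure.map_apply hQ (measurableSet_le_and_lt (by fun_prop) (by fun_prop)
        (by fun_prop) (by fun_prop))]
      refine (unif_quantile_le_sub ν μ _ _).trans ?_
      rw [← e1, ← e2]
      exact le_measure_sdiff.trans (measure_mono fun p hp => ⟨hp.1, not_le.1 hp.2⟩)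

/-! ### Energies as Lebesgue integrals -/

lemma integrable_sq_of_mem_P2 {μ : Measure ℝ} (hμ : μ ∈ P2) : Integrable (fun x => x ^ 2) μ := by
  refine ⟨by fun_prop, ?_⟩
  rw [hasFiniteIntegral_iff_ofReal (Eventually.of_forall fun x => sq_nonneg x)]
  exact hμ.2

lemma integrable_of_integrable_sq {Ω : Type*} [MeasurableSpace Ω] {P : Measure Ω}
    [IsFiniteMeasure P] {X : Ω → ℝ} (hX : AEStronglyMeasurable X P)
    (h : Integrable (fun ω => X ω ^ 2) P) : Integrable X P := by
  refine Integrable.mono' ((integrable_const (1 : ℝ)).add h) hX (Eventually.of_forall fun ω => ?_)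
  rw [Real.norm_eq_abs, Pi.add_apply, ← sq_abs]
  nlinarith [sq_nonneg (|X ω| - 1), abs_nonneg (X ω)]

lemma integrable_regKernel_comp {Ω : Type*} [MeasurableSpace Ω] {P : Measure Ω}
    [IsFiniteMeasure P] {X : Ω → ℝ} (hX : Integrable X P) {s ε : ℝ} (hs0 : 0 < s) (hs1 : s ≤ 1)
    (hε : 0 < ε) : Integrable (fun ω => regKernel s ε (X ω)) P := by
  obtain ⟨C, _, hC⟩ := abs_regKernel_le hs0 hs1 hε
  exact Integrable.mono' (((integrable_const (1 : ℝ)).add hX.abs).const_mul C)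
    ((continuous_regKernel hs0 hs1 hε).comp_aestronglyMeasurable hX.1)
    (Eventually.of_forall fun ω => hC _)

lemma integrable_fst_sub_snd {μ : Measure ℝ} [IsProbabilityMeasure μ] (hμ : μ ∈ P2) :
    Integrable (fun p : ℝ × ℝ => p.1 - p.2) (μ.prod μ) := by
  have h : Integrable (fun x : ℝ => x) μ :=
    integrable_of_integrable_sq (by fun_prop) (integrable_sq_of_mem_P2 hμ)
  exact (h.comp_fst μ).sub (h.comp_snd μ)

lemma extKernel_eq {s z : ℝ} (h : z = 0 → 1 / 2 < s) : extKernel s z = kernel s z := by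
  rw [extKernel, if_neg]
  rintro ⟨h0, h1⟩
  exact absurd (h h0) (not_lt.2 h1)

/-- The interaction energy is a Lebesgue integral over the real numbers as soon as the product
measure does not see the points where the kernel is infinite. -/
lemma interaction_eq_integral {s : ℝ} {μ : Measure ℝ}
    (hd : ∀ᵐ p ∂μ.prod μ, p.1 - p.2 = 0 → 1 / 2 < s)
    (hi : Integrable (fun p : ℝ × ℝ => kernel s (p.1 - p.2)) (μ.prod μ)) :
    interaction s μ = ((∫ p : ℝ × ℝ, kernel s (p.1 - p.2) ∂μ.prod μ : ℝ) : EReal) := by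
  have e1 : ∫⁻ p : ℝ × ℝ, (extKernel s (p.1 - p.2)).toENNReal ∂μ.prod μ =
      ∫⁻ p : ℝ × ℝ, ENNReal.ofReal (kernel s (p.1 - p.2)) ∂μ.prod μ := by
    refine lintegral_congr_ae ?_
    filter_upwards [hd] with p hp
    rw [extKernel_eq hp, EReal.real_coe_toENNReal]
  have e2 : ∫⁻ p : ℝ × ℝ, (-extKernel s (p.1 - p.2)).toENNReal ∂μ.prod μ =
      ∫⁻ p : ℝ × ℝ, ENNReal.ofReal (-kernel s (p.1 - p.2)) ∂μ.prod μ := by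
    refine lintegral_congr_ae ?_
    filter_upwards [hd] with p hp
    rw [extKernel_eq hp, ← EReal.coe_neg, EReal.real_coe_toENNReal]
  have f1 : ∫⁻ p : ℝ × ℝ, ENNReal.ofReal (kernel s (p.1 - p.2)) ∂μ.prod μ ≠ ∞ :=
    hi.lintegral_lt_top.ne
  have f2 : ∫⁻ p : ℝ × ℝ, ENNReal.ofReal (-kernel s (p.1 - p.2)) ∂μ.prod μ ≠ ∞ :=
    hi.neg.lintegral_lt_top.ne
  rw [interaction, e1, e2, integral_eq_lintegral_pos_part_sub_lintegral_neg_part hi,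
    EReal.coe_sub, EReal.coe_ennreal_toReal f1, EReal.coe_ennreal_toReal f2]

/-- The negative part of the kernel is integrable for finite second moment, so that a finite
interaction energy forces absolute convergence, and excludes atoms where the kernel is infinite. -/
lemma of_interaction_ne_top {s : ℝ} (hs0 : 0 < s) (hs1 : s ≤ 1) {μ : Measure ℝ}
    [IsProbabilityMeasure μ] (hμ : μ ∈ P2) (h : interaction s μ ≠ ⊤) :
    (∀ᵐ p ∂μ.prod μ, p.1 - p.2 = 0 → 1 / 2 < s) ∧
      Integrable (fun p : ℝ × ℝ => kernel s (p.1 - p.2)) (μ.prod μ) := by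
  have hreg := integrable_regKernel_comp (integrable_fst_sub_snd hμ) hs0 hs1 one_pos
  have hN : ∫⁻ p : ℝ × ℝ, (-extKernel s (p.1 - p.2)).toENNReal ∂μ.prod μ ≠ ∞ := by
    refine (lt_of_le_of_lt (lintegral_mono fun p => ?_) hreg.neg.lintegral_lt_top).ne
    by_cases hp : p.1 - p.2 = 0 → 1 / 2 < s
    · rw [extKernel_eq hp, ← EReal.coe_neg, EReal.real_coe_toENNReal]
      exact ENNReal.ofReal_le_ofReal (neg_le_neg (regKernel_le_kernel hs0 hs1 one_pos le_rfl hp))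
    · push Not at hp
      rw [extKernel, if_pos hp]
      simp
  have hP : ∫⁻ p : ℝ × ℝ, (extKernel s (p.1 - p.2)).toENNReal ∂μ.prod μ ≠ ∞ := by
    intro hP
    refine h ?_
    rw [interaction, hP, EReal.coe_ennreal_top]
    exact EReal.top_sub (by simpa using hN)
  have hm : Measurable fun z => (extKernel s z).toENNReal := by
    have : (fun z => (extKernel s z).toENNReal) =
        fun z => if z ∈ {z : ℝ | z = 0 ∧ s ≤ 1 / 2} then ∞ else ENNReal.ofReal (kernel s z) := by
      ext z; simp only [extKernel, mem_ofPred_eq]; split_ifs <;> simp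
    rw [this]
    refine Measurable.ite ?_ measurable_const (measurable_kernel s).ennreal_ofReal
    rw [Set.ofPred_and]
    exact (measurableSet_singleton 0).inter (MeasurableSet.const _)
  have hd : ∀ᵐ p ∂μ.prod μ, p.1 - p.2 = 0 → 1 / 2 < s := by
    filter_upwards [ae_lt_top (hm.comp (measurable_fst.sub measurable_snd)) hP] with p hp h0
    by_contra hs
    push Not at hs
    rw [Function.comp_apply, extKernel, if_pos ⟨h0, hs⟩] at hp
    simp at hp
  refine ⟨hd, ?_⟩
  have hmk : AEStronglyMeasurable (fun p : ℝ × ℝ => kernel s (p.1 - p.2)) (μ.prod μ) :=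
    ((measurable_kernel s).comp (measurable_fst.sub measurable_snd)).aestronglyMeasurable
  -- the kernel lies between the regularised kernel and its own positive part
  have hpos : Integrable (fun p : ℝ × ℝ => max (kernel s (p.1 - p.2)) 0) (μ.prod μ) := by
    refine ⟨hmk.sup aestronglyMeasurable_const, ?_⟩
    rw [hasFiniteIntegral_iff_ofReal
      (ae_of_all _ fun p : ℝ × ℝ => le_max_right (kernel s (p.1 - p.2)) 0)]
    refine lt_of_le_of_lt (lintegral_mono_ae ?_) hP.lt_top
    filter_upwards [hd] with p hp
    rw [extKernel_eq hp, EReal.real_coe_toENNReal, ENNReal.ofReal_max]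
    simp
  refine integrable_of_le_of_le hmk ?_ (Eventually.of_forall fun p => le_max_left _ _) hreg hpos
  filter_upwards [hd] with p hp
  exact regKernel_le_kernel hs0 hs1 one_pos le_rfl hp

lemma energy_eq_coe {s lam : ℝ} {μ : Measure ℝ}
    (hd : ∀ᵐ p ∂μ.prod μ, p.1 - p.2 = 0 → 1 / 2 < s)
    (hi : Integrable (fun p : ℝ × ℝ => kernel s (p.1 - p.2)) (μ.prod μ)) :
    energy s lam μ = ((1 / 2 * (∫ p : ℝ × ℝ, kernel s (p.1 - p.2) ∂μ.prod μ) +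
      lam / 2 * ∫ x, x ^ 2 ∂μ : ℝ) : EReal) := by
  rw [energy, interaction_eq_integral hd hi, EReal.coe_add, EReal.coe_mul (1 / 2)]

lemma interaction_ne_top_of_energy_ne_top {s lam : ℝ} {μ : Measure ℝ}
    (h : energy s lam μ ≠ ⊤) : interaction s μ ≠ ⊤ := by
  intro h'
  refine h ?_
  rw [energy, h', EReal.coe_mul_top_of_pos (by norm_num), EReal.top_add_coe]

section Law

variable {ρ : ℝ → ℝ}

lemma integrable_law_iff (hm : Measurable ρ) (h0 : ∀ x, 0 ≤ ρ x) (f : ℝ → ℝ) :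
    Integrable f (law ρ) ↔ Integrable fun x => f x * ρ x := by
  rw [law, integrable_withDensity_iff (by fun_prop) (Eventually.of_forall fun x => by simp)]
  simp only [ENNReal.toReal_ofReal (h0 _)]

lemma integral_law (hm : Measurable ρ) (h0 : ∀ x, 0 ≤ ρ x) (f : ℝ → ℝ) :
    ∫ x, f x ∂law ρ = ∫ x, f x * ρ x := by
  rw [law, integral_withDensity_eq_integral_toReal_smul (by fun_prop)
    (Eventually.of_forall fun x => by simp)]
  simp only [ENNReal.toReal_ofReal (h0 _), smul_eq_mul, mul_comm]

lemma isProbabilityMeasure_law (hi : Integrable ρ) (h0 : ∀ x, 0 ≤ ρ x) (h1 : ∫ x, ρ x = 1) :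
    IsProbabilityMeasure (law ρ) := by
  refine ⟨?_⟩
  rw [law, withDensity_apply _ MeasurableSet.univ, Measure.restrict_univ,
    ← ofReal_integral_eq_lintegral_ofReal hi (Eventually.of_forall h0), h1, ENNReal.ofReal_one]

lemma law_mem_P2 (hm : Measurable ρ) (hi : Integrable ρ) (h0 : ∀ x, 0 ≤ ρ x) (h1 : ∫ x, ρ x = 1)
    (h2 : Integrable fun x => x ^ 2 * ρ x) : law ρ ∈ P2 := by
  refine ⟨isProbabilityMeasure_law hi h0 h1, ?_⟩
  rw [← hasFiniteIntegral_iff_ofReal (Eventually.of_forall fun x => sq_nonneg x)]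
  exact ((integrable_law_iff hm h0 _).2 h2).2

lemma exists_law_le (h : MemLp ρ ∞ volume) : ∃ M : ℝ≥0, law ρ ≤ M • (volume : Measure ℝ) := by
  have hlt : eLpNormEssSup ρ volume ≠ ∞ := by
    have := h.2
    rw [eLpNorm_exponent_top] at this
    exact this.ne
  refine ⟨(eLpNormEssSup ρ volume).toNNReal, ?_⟩
  have hc : ((eLpNormEssSup ρ volume).toNNReal • volume : Measure ℝ) =
      volume.withDensity fun _ => eLpNormEssSup ρ volume := by
    rw [withDensity_const, ← ENNReal.coe_toNNReal hlt]; rfl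
  rw [law, hc]
  refine withDensity_mono ?_
  filter_upwards [enorm_ae_le_eLpNormEssSup ρ volume] with x hx
  exact (Real.ofReal_le_enorm _).trans hx

lemma ae_prod_law_sub_ne_zero [SFinite (law ρ)] :
    ∀ᵐ p ∂(law ρ).prod (law ρ), p.1 - p.2 ≠ 0 := by
  have hac : law ρ ≪ volume := withDensity_absolutelyContinuous _ _
  have hms : MeasurableSet {p : ℝ × ℝ | p.1 - p.2 = 0} :=
    measurableSet_eq_fun (by fun_prop) (by fun_prop)
  have : (law ρ).prod (law ρ) {p : ℝ × ℝ | p.1 - p.2 = 0} = 0 := by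
    rw [Measure.measure_prod_null hms]
    refine Eventually.of_forall fun x => hac ?_
    have : Prod.mk x ⁻¹' {p : ℝ × ℝ | p.1 - p.2 = 0} = {x} := by
      ext y; simp [sub_eq_zero, eq_comm]
    rw [this]; simp
  rw [ae_iff]
  simpa using this

lemma integrable_excess_law {s : ℝ} (hs0 : 0 < s) (hs1 : s ≤ 1) {M : ℝ≥0}
    (hM : law ρ ≤ M • (volume : Measure ℝ)) (x : ℝ) :
    Integrable (fun y => kernel s (x - y) - regKernel s 1 (x - y)) (law ρ) :=
  ((((integrable_kernel_sub_regKernel hs0 hs1).comp_sub_left x).smul_measure_nnreal).mono_measure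
    hM)

lemma integrable_kernel_law {s : ℝ} (hs0 : 0 < s) (hs1 : s ≤ 1) [IsProbabilityMeasure (law ρ)]
    (hρ : law ρ ∈ P2) {M : ℝ≥0} (hM : law ρ ≤ M • (volume : Measure ℝ)) (x : ℝ) :
    Integrable (fun y => kernel s (x - y)) (law ρ) := by
  have hid : Integrable (fun y : ℝ => y) (law ρ) :=
    integrable_of_integrable_sq (by fun_prop) (integrable_sq_of_mem_P2 hρ)
  have h1 := integrable_regKernel_comp ((integrable_const x).sub hid) hs0 hs1 one_pos
  refine (h1.add (integrable_excess_law hs0 hs1 hM x)).congr (Eventually.of_forall fun y => ?_)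
  simp

/-- A bounded density has finite interaction energy: `W` differs from a Lipschitz function by an
integrable one. -/
lemma integrable_kernel_prod_law {s : ℝ} (hs0 : 0 < s) (hs1 : s ≤ 1)
    [IsProbabilityMeasure (law ρ)]
    (hρ : law ρ ∈ P2) {M : ℝ≥0} (hM : law ρ ≤ M • (volume : Measure ℝ)) :
    Integrable (fun p : ℝ × ℝ => kernel s (p.1 - p.2)) ((law ρ).prod (law ρ)) := by
  have h1 := integrable_regKernel_comp (integrable_fst_sub_snd hρ) hs0 hs1 one_pos
  set V : ℝ → ℝ := fun z => kernel s z - regKernel s 1 z with hV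
  have hVm : Measurable V :=
    (measurable_kernel s).sub (continuous_regKernel hs0 hs1 one_pos).measurable
  have hVi : Integrable V := integrable_kernel_sub_regKernel hs0 hs1
  have hb : ∀ x, ∫ y, ‖V (x - y)‖ ∂law ρ ≤ M * ∫ z, ‖V z‖ := fun x => by
    calc ∫ y, ‖V (x - y)‖ ∂law ρ ≤ ∫ y, ‖V (x - y)‖ ∂(M • (volume : Measure ℝ)) :=
          integral_mono_measure hM (Eventually.of_forall fun _ => norm_nonneg _)
            ((hVi.comp_sub_left x).norm.smul_measure_nnreal)
      _ = M * ∫ z, ‖V z‖ := by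
          rw [integral_smul_nnreal_measure, NNReal.smul_def, smul_eq_mul,
            integral_sub_left_eq_self (fun z => ‖V z‖) volume x]
  have h2 : Integrable (fun p : ℝ × ℝ => V (p.1 - p.2)) ((law ρ).prod (law ρ)) := by
    have hm : AEStronglyMeasurable (fun p : ℝ × ℝ => V (p.1 - p.2)) ((law ρ).prod (law ρ)) :=
      (hVm.comp (measurable_fst.sub measurable_snd)).aestronglyMeasurable
    rw [integrable_prod_iff hm]
    refine ⟨Eventually.of_forall fun x => integrable_excess_law hs0 hs1 hM x, ?_⟩
    refine Integrable.mono' (integrable_const (M * ∫ z, ‖V z‖)) hm.norm.integral_prod_right'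
      (Eventually.of_forall fun x => ?_)
    rw [Real.norm_of_nonneg (integral_nonneg fun _ => norm_nonneg _)]
    exact hb x
  refine (h1.add h2).congr (Eventually.of_forall fun p => ?_)
  simp [hV]

end Law

/-! ### Differentiability of the Riesz potential -/

section Potential

variable {s : ℝ}

lemma hasDerivAt_integral_regKernel (hs0 : 0 < s) (hs1 : s ≤ 1) {ε : ℝ} (hε : 0 < ε)
    {m : Measure ℝ} [IsProbabilityMeasure m] [NullSingletonClass m] (hm : Integrable (fun y => y) m) (x : ℝ) :
    HasDerivAt (fun x => ∫ y, regKernel s ε (x - y) ∂m) (∫ y, regSlope s ε (x - y) ∂m) x := by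
  have hc := continuous_regKernel hs0 hs1 hε
  have hk : 0 ≤ slopeConst s * ε ^ (2 * s - 2) :=
    mul_nonneg (slopeConst_nonneg hs0 hs1) (Real.rpow_nonneg hε.le _)
  refine (hasDerivAt_integral_of_dominated_loc_of_lip (s := univ)
    (bound := fun _ => slopeConst s * ε ^ (2 * s - 2)) univ_mem
    (Eventually.of_forall fun x => ?_) ?_ ?_ ?_ (integrable_const _) ?_).2
  · exact (hc.comp (by fun_prop)).aestronglyMeasurable
  · exact integrable_regKernel_comp ((integrable_const x).sub hm) hs0 hs1 hε
  · exact ((measurable_regSlope s ε).comp (by fun_prop)).aestronglyMeasurable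
  · refine Eventually.of_forall fun y => ?_
    refine LipschitzOnWith.of_dist_le_mul fun a _ b _ => ?_
    rw [Real.dist_eq, Real.dist_eq, Real.coe_nnabs, abs_of_nonneg hk]
    have := abs_regKernel_sub_le hs0 hs1 hε (b - y) (a - y)
    rwa [sub_sub_sub_cancel_right] at this
  · have : ∀ᵐ y ∂m, y ≠ x := by rw [ae_iff]; simp
    filter_upwards [this] with y hy
    have h1 := hasDerivAt_regKernel s hε (sub_ne_zero.2 hy.symm)
    simpa using h1.comp_sub_const x y

/-- The singular integrand of the derivative of the potential near the origin, estimated by means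
of Hölder continuity of the density with constant `C` and exponent `a`. -/
noncomputable def holderMajorant (s C a z : ℝ) : ℝ :=
  slopeConst s * |z| ^ (2 * s - 2) * (C * (2 * |z|) ^ a)

lemma holderMajorant_nonneg (hs0 : 0 < s) (hs1 : s ≤ 1) {C : ℝ} (hC : 0 ≤ C) (a z : ℝ) :
    0 ≤ holderMajorant s C a z := by
  have := slopeConst_nonneg hs0 hs1
  unfold holderMajorant
  positivity

lemma measurable_holderMajorant (s C a : ℝ) : Measurable (holderMajorant s C a) := by
  unfold holderMajorant
  fun_prop

lemma integrableOn_holderMajorant (C : ℝ) {a : ℝ} (ha : 1 - 2 * s < a) :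
    IntegrableOn (holderMajorant s C a) (Ioo (-1) 1) := by
  have hpow : IntervalIntegrable (fun z : ℝ => |z| ^ (2 * s - 2 + a)) volume (-1) 1 :=
    intervalIntegrable_abs_rpow (by linarith)
  have h2 : IntegrableOn (fun z : ℝ => slopeConst s * C * 2 ^ a * |z| ^ (2 * s - 2 + a))
      (Ioo (-1) 1) :=
    ((intervalIntegrable_iff_integrableOn_Ioo_of_le (by norm_num)).1 hpow).const_mul _
  refine Integrable.congr h2 ?_
  have h0 : ∀ᵐ z ∂(volume.restrict (Ioo (-1) 1) : Measure ℝ), z ≠ 0 := by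
    rw [ae_iff]; simp
  filter_upwards [h0] with z hz
  rw [holderMajorant, Real.mul_rpow zero_le_two (abs_nonneg z), Real.rpow_add (abs_pos.2 hz)]
  ring

/-- The integral of the majorant over the points at distance less than `ε` from the origin, which
controls the error of the regularisation at scale `ε`. -/
noncomputable def slopeError (s C a ε : ℝ) : ℝ :=
  ∫ z, (Ioo (-ε) ε).indicator (holderMajorant s C a) z

lemma integrable_indicator_holderMajorant (C : ℝ) {a : ℝ} (ha : 1 - 2 * s < a)
    {ε : ℝ} (hε1 : ε ≤ 1) :
    Integrable ((Ioo (-ε) ε).indicator (holderMajorant s C a)) :=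
  (integrable_indicator_iff measurableSet_Ioo).2
    ((integrableOn_holderMajorant C ha).mono_set (Ioo_subset_Ioo (by linarith) hε1))

lemma tendsto_slopeError (hs0 : 0 < s) (hs1 : s ≤ 1) {C : ℝ} (hC : 0 ≤ C) {a : ℝ}
    (ha : 1 - 2 * s < a) {u : ℕ → ℝ} (hu1 : ∀ n, u n ≤ 1) (hu : Tendsto u atTop (𝓝 0)) :
    Tendsto (fun n => slopeError s C a (u n)) atTop (𝓝 0) := by
  rw [← integral_zero ℝ ℝ (μ := volume)]
  refine tendsto_integral_of_dominated_convergence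
    ((Ioo (-1) 1).indicator (holderMajorant s C a))
    (fun n => ((measurable_holderMajorant s C a).indicator measurableSet_Ioo).aestronglyMeasurable)
    (integrable_indicator_holderMajorant C ha le_rfl)
    (fun n => Eventually.of_forall fun z => ?_) ?_
  · rw [Real.norm_of_nonneg (indicator_nonneg (fun z _ => holderMajorant_nonneg hs0 hs1 hC a z) z)]
    exact indicator_le_indicator_of_subset (Ioo_subset_Ioo (neg_le_neg (hu1 n)) (hu1 n))
      (fun z => holderMajorant_nonneg hs0 hs1 hC a z) z
  · have h0 : ∀ᵐ z ∂(volume : Measure ℝ), z ≠ 0 := by rw [ae_iff]; simp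
    filter_upwards [h0] with z hz
    refine tendsto_const_nhds.congr' ?_
    filter_upwards [hu.eventually (gt_mem_nhds (abs_pos.2 hz))] with n hn
    rw [indicator_of_notMem]
    exact fun h => absurd (abs_lt.2 h) (not_lt.2 hn.le)

lemma abs_regSlope_zero_sub_le (hs0 : 0 < s) (hs1 : s ≤ 1) {ε : ℝ} (hε : 0 < ε) (z : ℝ) :
    |regSlope s 0 z - regSlope s ε z| ≤
      (Ioo (-ε) ε).indicator (fun z => slopeConst s * |z| ^ (2 * s - 2)) z := by
  have hk := slopeConst_nonneg hs0 hs1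
  by_cases h : z ∈ Ioo (-ε) ε
  · rw [indicator_of_mem h]
    rcases eq_or_ne z 0 with rfl | hz
    · simp only [regSlope, sign_zero]
      simpa using mul_nonneg hk (Real.rpow_nonneg le_rfl _)
    have hz' := abs_pos.2 hz
    have h1 : cutPow s 0 |z| = |z| ^ (2 * s - 2) := by rw [cutPow, max_eq_left hz'.le]
    have h2 : cutPow s ε |z| ≤ |z| ^ (2 * s - 2) :=
      Real.rpow_le_rpow_of_nonpos hz' (le_max_left _ _) (by linarith)
    have h3 := cutPow_nonneg s hε.le |z|
    have h4 : regSlope s 0 z - regSlope s ε z =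
        -(slopeConst s * (|z| ^ (2 * s - 2) - cutPow s ε |z|) * (SignType.sign z : ℝ)) := by
      rw [regSlope, regSlope, h1]; ring
    have h5 : 0 ≤ slopeConst s * (|z| ^ (2 * s - 2) - cutPow s ε |z|) :=
      mul_nonneg hk (by linarith)
    rw [h4, abs_neg, abs_mul, abs_of_nonneg h5]
    refine (mul_le_of_le_one_right h5 (abs_sign_le_one z)).trans ?_
    exact mul_le_mul_of_nonneg_left (by linarith) hk
  · have hz : ε ≤ |z| := by
      by_contra hlt
      exact h (abs_lt.1 (not_le.1 hlt))
    rw [indicator_of_notMem h, regSlope, regSlope, cutPow, cutPow, max_eq_left hz,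
      max_eq_left (abs_nonneg z), sub_self, abs_zero]

/-- The derivative of the Riesz potential of `ρ`. The symmetrised difference of `ρ` makes the
singular integral absolutely convergent. -/
noncomputable def potentialSlope (s : ℝ) (ρ : ℝ → ℝ) (x : ℝ) : ℝ :=
  1 / 2 * ∫ z, regSlope s 0 z * (ρ (x - z) - ρ (x + z))

lemma integral_regSlope_law (hs0 : 0 < s) (hs1 : s ≤ 1) {ρ : ℝ → ℝ} (hm : Measurable ρ)
    (h0 : ∀ x, 0 ≤ ρ x) (hi : Integrable ρ) {ε : ℝ} (hε : 0 < ε) (x : ℝ) :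
    Integrable (fun z => regSlope s ε z * (ρ (x - z) - ρ (x + z))) ∧
    ∫ y, regSlope s ε (x - y) ∂law ρ =
      1 / 2 * ∫ z, regSlope s ε z * (ρ (x - z) - ρ (x + z)) := by
  have hmul : ∀ f : ℝ → ℝ, Integrable f → Integrable fun z => regSlope s ε z * f z := fun f hf =>
    hf.bdd_mul (measurable_regSlope s ε).aestronglyMeasurable
      (Eventually.of_forall fun z => abs_regSlope_le_const hs0 hs1 hε z)
  have i1 := hmul _ (hi.comp_sub_left x)
  have i2 := hmul _ (hi.comp_add_left x)
  have e1 : ∫ y, regSlope s ε (x - y) ∂law ρ = ∫ z, regSlope s ε z * ρ (x - z) := by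
    rw [integral_law hm h0, ← integral_sub_left_eq_self _ volume x]
    simp
  have e2 : ∫ z, regSlope s ε z * ρ (x - z) = -∫ z, regSlope s ε z * ρ (x + z) := by
    rw [← integral_neg_eq_self (fun z => regSlope s ε z * ρ (x - z)) volume, ← integral_neg]
    simp [regSlope_neg]
  simp only [mul_sub]
  refine ⟨i1.sub i2, ?_⟩
  rw [integral_sub i1 i2, e1]
  linarith

/-- The derivatives of the regularised potentials converge uniformly. -/
lemma abs_integral_regSlope_sub_le (hs0 : 0 < s) (hs1 : s ≤ 1) {ρ : ℝ → ℝ} (hm : Measurable ρ)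
    (h0 : ∀ x, 0 ≤ ρ x) (hi : Integrable ρ) {C α : ℝ≥0} (hα : 1 - 2 * s < α)
    (hC : HolderWith C α ρ) {ε : ℝ} (hε : 0 < ε) (hε1 : ε ≤ 1) (x : ℝ) :
    |(∫ y, regSlope s ε (x - y) ∂law ρ) - potentialSlope s ρ x| ≤ slopeError s C α ε := by
  obtain ⟨i1, e1⟩ := integral_regSlope_law hs0 hs1 hm h0 hi hε x
  have hb : ∀ z, |regSlope s 0 z * (ρ (x - z) - ρ (x + z)) -
      regSlope s ε z * (ρ (x - z) - ρ (x + z))| ≤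
        (Ioo (-ε) ε).indicator (holderMajorant s C α) z := by
    intro z
    rw [← sub_mul, abs_mul]
    have hH : |ρ (x - z) - ρ (x + z)| ≤ C * (2 * |z|) ^ (α : ℝ) := by
      have := hC.dist_le (x - z) (x + z)
      rwa [Real.dist_eq, Real.dist_eq, show x - z - (x + z) = -(2 * z) by ring, abs_neg, abs_mul,
        abs_two] at this
    refine (mul_le_mul (abs_regSlope_zero_sub_le hs0 hs1 hε z) hH (abs_nonneg _)
      (indicator_nonneg (fun z _ => mul_nonneg (slopeConst_nonneg hs0 hs1)
        (Real.rpow_nonneg (abs_nonneg z) _)) z)).trans_eq ?_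
    by_cases h : z ∈ Ioo (-ε) ε
    · rw [indicator_of_mem h, indicator_of_mem h, holderMajorant]
    · rw [indicator_of_notMem h, indicator_of_notMem h, zero_mul]
  have hint := integrable_indicator_holderMajorant (s := s) C hα hε1
  have i2 : Integrable fun z => regSlope s 0 z * (ρ (x - z) - ρ (x + z)) -
      regSlope s ε z * (ρ (x - z) - ρ (x + z)) := by
    refine hint.mono' ?_ (Eventually.of_forall hb)
    have hd : Measurable fun z => ρ (x - z) - ρ (x + z) := by fun_prop
    exact (((measurable_regSlope s 0).mul hd).sub
      ((measurable_regSlope s ε).mul hd)).aestronglyMeasurable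
  have i0 : Integrable fun z => regSlope s 0 z * (ρ (x - z) - ρ (x + z)) :=
    (i2.add i1).congr (Eventually.of_forall fun z => by simp)
  have hle : |∫ z, (regSlope s 0 z * (ρ (x - z) - ρ (x + z)) -
      regSlope s ε z * (ρ (x - z) - ρ (x + z)))| ≤ slopeError s C α ε :=
    (abs_integral_le_integral_abs).trans (integral_mono i2.abs hint hb)
  rw [integral_sub i0 i1] at hle
  rw [e1, potentialSlope, ← mul_sub, abs_mul, abs_sub_comm, abs_of_pos (by norm_num)]
  linarith [abs_nonneg ((∫ z, regSlope s 0 z * (ρ (x - z) - ρ (x + z))) -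
    ∫ z, regSlope s ε z * (ρ (x - z) - ρ (x + z)))]

lemma tendsto_regKernel {u : ℕ → ℝ} (hu0 : ∀ n, 0 < u n) (hu1 : ∀ n, u n ≤ 1)
    (hu : Tendsto u atTop (𝓝 0)) {z : ℝ} (hz : z ≠ 0) :
    Tendsto (fun n => regKernel s (u n) z) atTop (𝓝 (kernel s z)) := by
  refine tendsto_const_nhds.congr' ?_
  filter_upwards [hu.eventually (gt_mem_nhds (abs_pos.2 hz))] with n hn
  exact (regKernel_eq_kernel s (hu0 n) (hu1 n) hn.le).symm

/-- Integrals of the regularised kernels converge to the integral of the kernel, wherever the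
latter converges absolutely. -/
lemma tendsto_integral_regKernel (hs0 : 0 < s) (hs1 : s ≤ 1) {Ω : Type*} [MeasurableSpace Ω]
    {P : Measure Ω} [IsFiniteMeasure P] {X : Ω → ℝ} (hX : Integrable X P) (hX0 : ∀ᵐ ω ∂P, X ω ≠ 0)
    (hk : Integrable (fun ω => kernel s (X ω)) P) {u : ℕ → ℝ} (hu0 : ∀ n, 0 < u n)
    (hu1 : ∀ n, u n ≤ 1) (hu : Tendsto u atTop (𝓝 0)) :
    Tendsto (fun n => ∫ ω, regKernel s (u n) (X ω) ∂P) atTop (𝓝 (∫ ω, kernel s (X ω) ∂P)) := by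
  refine tendsto_integral_of_dominated_convergence
    (fun ω => |regKernel s 1 (X ω)| + |kernel s (X ω)|)
    (fun n => (integrable_regKernel_comp hX hs0 hs1 (hu0 n)).1)
    ((integrable_regKernel_comp hX hs0 hs1 one_pos).abs.add hk.abs) (fun n => ?_) ?_
  · filter_upwards [hX0] with ω hω
    have h1 := regKernel_anti hs0 hs1 (hu0 n) (hu1 n) le_rfl (X ω)
    have h2 := regKernel_le_kernel hs0 hs1 (hu0 n) (hu1 n) fun h => absurd h hω
    rw [Real.norm_eq_abs, abs_le]
    constructor
    · linarith [neg_abs_le (regKernel s 1 (X ω)), abs_nonneg (kernel s (X ω))]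
    · linarith [le_abs_self (kernel s (X ω)), abs_nonneg (regKernel s 1 (X ω))]
  · filter_upwards [hX0] with ω hω using tendsto_regKernel hu0 hu1 hu hω

lemma nullSingletonClass_law (ρ : ℝ → ℝ) : NullSingletonClass (law ρ) :=
  ⟨fun x => withDensity_absolutelyContinuous _ _ (by simp)⟩

theorem hasDerivAt_rieszPotential (hs0 : 0 < s) (hs1 : s ≤ 1) {ρ : ℝ → ℝ} (hm : Measurable ρ)
    (h0 : ∀ x, 0 ≤ ρ x) (hi : Integrable ρ) [IsProbabilityMeasure (law ρ)] (hρ : law ρ ∈ P2)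
    {M : ℝ≥0} (hM : law ρ ≤ M • (volume : Measure ℝ)) {C α : ℝ≥0} (hα : 1 - 2 * s < α)
    (hC : HolderWith C α ρ) (x : ℝ) :
    HasDerivAt (rieszPotential s ρ) (potentialSlope s ρ x) x := by
  have := nullSingletonClass_law ρ
  have hid : Integrable (fun y : ℝ => y) (law ρ) :=
    integrable_of_integrable_sq (by fun_prop) (integrable_sq_of_mem_P2 hρ)
  set u : ℕ → ℝ := fun n => 1 / (n + 1) with hu
  have hu0 : ∀ n, 0 < u n := fun n => Nat.one_div_pos_of_nat
  have hu1 : ∀ n, u n ≤ 1 := fun n => by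
    rw [hu]; exact div_le_one_of_le₀ (by linarith [n.cast_nonneg (α := ℝ)]) (by positivity)
  have hulim : Tendsto u atTop (𝓝 0) := tendsto_one_div_add_atTop_nhds_zero_nat
  refine hasDerivAt_of_tendstoUniformly (l := atTop)
    (f := fun n x => ∫ y, regKernel s (u n) (x - y) ∂law ρ)
    (f' := fun n x => ∫ y, regSlope s (u n) (x - y) ∂law ρ) ?_
    (Eventually.of_forall fun n x => hasDerivAt_integral_regKernel hs0 hs1 (hu0 n) hid x)
    (fun x => ?_) x
  · rw [Metric.tendstoUniformly_iff]
    intro δ hδ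
    filter_upwards [(tendsto_slopeError hs0 hs1 C.2 hα hu1 hulim).eventually (gt_mem_nhds hδ)]
      with n hn x
    rw [dist_comm, Real.dist_eq]
    exact (abs_integral_regSlope_sub_le hs0 hs1 hm h0 hi hα hC (hu0 n) (hu1 n) x).trans_lt hn
  · rw [rieszPotential, ← integral_law hm h0 fun y => kernel s (x - y)]
    refine tendsto_integral_regKernel hs0 hs1 ((integrable_const x).sub hid) ?_
      (integrable_kernel_law hs0 hs1 hρ hM x) hu0 hu1 hulim
    have : ∀ᵐ y ∂law ρ, y ≠ x := by rw [ae_iff]; simp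
    filter_upwards [this] with y hy
    exact sub_ne_zero.2 hy.symm

lemma abs_integral_regSlope_le (hs0 : 0 < s) (hs1 : s ≤ 1) {ε : ℝ} (hε : 0 < ε)
    {m : Measure ℝ} [IsProbabilityMeasure m] (x : ℝ) :
    |∫ y, regSlope s ε (x - y) ∂m| ≤ slopeConst s * ε ^ (2 * s - 2) := by
  have := norm_integral_le_of_norm_le_const (μ := m)
    (f := fun y => regSlope s ε (x - y))
    (Eventually.of_forall fun y => abs_regSlope_le_const hs0 hs1 hε (x - y))
  simpa using this

lemma exists_abs_potentialSlope_le (hs0 : 0 < s) (hs1 : s ≤ 1) {ρ : ℝ → ℝ} (hm : Measurable ρ)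
    (h0 : ∀ x, 0 ≤ ρ x) (hi : Integrable ρ) [IsProbabilityMeasure (law ρ)]
    {C α : ℝ≥0} (hα : 1 - 2 * s < α) (hC : HolderWith C α ρ) :
    ∃ B, ∀ x, |potentialSlope s ρ x| ≤ B := by
  refine ⟨slopeConst s * 1 ^ (2 * s - 2) + slopeError s C α 1, fun x => ?_⟩
  have h1 := abs_integral_regSlope_le (m := law ρ) hs0 hs1 one_pos x
  have h2 := abs_integral_regSlope_sub_le hs0 hs1 hm h0 hi hα hC one_pos le_rfl x
  rw [abs_le] at *
  constructor <;> linarith [h1.1, h1.2, h2.1, h2.2]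

end Potential

/-! ### Convexity of the energy along a monotone coupling -/

section Coupling

variable {s : ℝ} {μ ν : Measure ℝ} {π : Measure (ℝ × ℝ)}

/-- The energy as a real number. It agrees with `energy` where the kernel is integrable and finite
almost everywhere. -/
noncomputable def realEnergy (s lam : ℝ) (μ : Measure ℝ) : ℝ :=
  1 / 2 * (∫ p : ℝ × ℝ, kernel s (p.1 - p.2) ∂μ.prod μ) + lam / 2 * ∫ x, x ^ 2 ∂μ

lemma integral_prod_comp {f : ℝ × ℝ → ℝ} (hf : Measurable f) [SFinite μ] [SFinite π]
    {T : ℝ × ℝ → ℝ} (hT : MeasurePreserving T π μ) :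
    ∫ q : (ℝ × ℝ) × (ℝ × ℝ), f (T q.1, T q.2) ∂π.prod π = ∫ p, f p ∂μ.prod μ := by
  have h := hT.prod hT
  rw [← h.map_eq, integral_map h.aemeasurable hf.aestronglyMeasurable]
  rfl

lemma integrable_prod_comp {f : ℝ × ℝ → ℝ} (hf : Measurable f) [SFinite μ] [SFinite π]
    {T : ℝ × ℝ → ℝ} (hT : MeasurePreserving T π μ) :
    Integrable (fun q : (ℝ × ℝ) × (ℝ × ℝ) => f (T q.1, T q.2)) (π.prod π) ↔
      Integrable f (μ.prod μ) :=
  (hT.prod hT).integrable_comp hf.aestronglyMeasurable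

lemma measurable_kernel_sub (s : ℝ) : Measurable fun p : ℝ × ℝ => kernel s (p.1 - p.2) :=
  (measurable_kernel s).comp (measurable_fst.sub measurable_snd)

lemma measurable_regKernel_sub (hs0 : 0 < s) (hs1 : s ≤ 1) {ε : ℝ} (hε : 0 < ε) :
    Measurable fun p : ℝ × ℝ => regKernel s ε (p.1 - p.2) :=
  (continuous_regKernel hs0 hs1 hε).measurable.comp (measurable_fst.sub measurable_snd)

lemma stronglyMeasurable_integral_regSlope (s ε : ℝ) (μ : Measure ℝ) [SFinite μ] :
    StronglyMeasurable fun x => ∫ y, regSlope s ε (x - y) ∂μ :=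
  StronglyMeasurable.integral_prod_right (f := fun x y => regSlope s ε (x - y))
    ((measurable_regSlope s ε).comp (measurable_fst.sub measurable_snd)).stronglyMeasurable

/-- The antisymmetry of `W'` turns the first variation of the interaction energy along a
displacement field into a single integral. -/
lemma integral_regSlope_mul_sub [IsProbabilityMeasure π] [IsProbabilityMeasure μ]
    (hfst : MeasurePreserving Prod.fst π μ) (hs0 : 0 < s) (hs1 : s ≤ 1) {ε : ℝ} (hε : 0 < ε)
    {v : ℝ × ℝ → ℝ} (hv : Integrable v π) :
    Integrable (fun q : (ℝ × ℝ) × (ℝ × ℝ) =>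
      regSlope s ε (q.1.1 - q.2.1) * (v q.1 - v q.2)) (π.prod π) ∧
    ∫ q : (ℝ × ℝ) × (ℝ × ℝ), regSlope s ε (q.1.1 - q.2.1) * (v q.1 - v q.2) ∂π.prod π =
      2 * ∫ p, (∫ y, regSlope s ε (p.1 - y) ∂μ) * v p ∂π := by
  have hm : Measurable fun q : (ℝ × ℝ) × (ℝ × ℝ) => regSlope s ε (q.1.1 - q.2.1) :=
    (measurable_regSlope s ε).comp (by fun_prop)
  have i1 : Integrable (fun q : (ℝ × ℝ) × (ℝ × ℝ) => regSlope s ε (q.1.1 - q.2.1) * v q.1)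
      (π.prod π) :=
    (hv.comp_fst π).bdd_mul hm.aestronglyMeasurable
      (Eventually.of_forall fun q => abs_regSlope_le_const hs0 hs1 hε _)
  have hswap : ∀ q : (ℝ × ℝ) × (ℝ × ℝ), regSlope s ε (q.1.1 - q.2.1) * v q.2 =
      -(fun q : (ℝ × ℝ) × (ℝ × ℝ) => regSlope s ε (q.1.1 - q.2.1) * v q.1) q.swap := fun q => by
    rw [← neg_sub, regSlope_neg]; simp
  have i2 : Integrable (fun q : (ℝ × ℝ) × (ℝ × ℝ) => regSlope s ε (q.1.1 - q.2.1) * v q.2)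
      (π.prod π) := by
    simp only [hswap]
    exact i1.swap.neg
  have e1 : ∫ q : (ℝ × ℝ) × (ℝ × ℝ), regSlope s ε (q.1.1 - q.2.1) * v q.1 ∂π.prod π =
      ∫ p, (∫ y, regSlope s ε (p.1 - y) ∂μ) * v p ∂π := by
    rw [integral_prod _ i1]
    refine integral_congr_ae (Eventually.of_forall fun p => ?_)
    have hms : Measurable fun y => regSlope s ε (p.1 - y) :=
      (measurable_regSlope s ε).comp (by fun_prop)
    simp only
    rw [integral_mul_const, ← hfst.map_eq,
      integral_map measurable_fst.aemeasurable hms.aestronglyMeasurable]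
  have e2 : ∫ q : (ℝ × ℝ) × (ℝ × ℝ), regSlope s ε (q.1.1 - q.2.1) * v q.2 ∂π.prod π =
      -∫ p, (∫ y, regSlope s ε (p.1 - y) ∂μ) * v p ∂π := by
    simp only [hswap]
    rw [integral_neg, ← e1]
    exact congrArg Neg.neg (integral_prod_swap (μ := π) (ν := π)
      fun q : (ℝ × ℝ) × (ℝ × ℝ) => regSlope s ε (q.1.1 - q.2.1) * v q.1)
  simp only [mul_sub]
  refine ⟨i1.sub i2, ?_⟩
  rw [integral_sub i1 i2, e1, e2]
  ring

lemma integrable_sq_coupling (hfst : MeasurePreserving Prod.fst π μ)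
    (hsnd : MeasurePreserving Prod.snd π ν) (hμ : μ ∈ P2) (hν : ν ∈ P2) :
    Integrable (fun p => p.1 ^ 2) π ∧ Integrable (fun p => p.2 ^ 2) π ∧
      Integrable (fun p => (p.2 - p.1) ^ 2) π := by
  have h1 : Integrable (fun p : ℝ × ℝ => p.1 ^ 2) π :=
    (hfst.integrable_comp (by fun_prop)).2 (integrable_sq_of_mem_P2 hμ)
  have h2 : Integrable (fun p : ℝ × ℝ => p.2 ^ 2) π :=
    (hsnd.integrable_comp (by fun_prop)).2 (integrable_sq_of_mem_P2 hν)
  refine ⟨h1, h2, ((h1.const_mul 2).add (h2.const_mul 2)).mono' (by fun_prop)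
    (Eventually.of_forall fun p => ?_)⟩
  rw [Real.norm_of_nonneg (sq_nonneg _), Pi.add_apply]
  nlinarith [sq_nonneg (p.1 + p.2)]

variable [IsProbabilityMeasure μ] [IsProbabilityMeasure ν] [IsProbabilityMeasure π]

/-- The first-order convexity inequality for the interaction energy along a monotone coupling, with
the regularised kernel at the starting point. -/
lemma interaction_regKernel_le (hfst : MeasurePreserving Prod.fst π μ)
    (hsnd : MeasurePreserving Prod.snd π ν) (hμ : μ ∈ P2) (hν : ν ∈ P2)
    (hmono : ∀ᵐ q ∂π.prod π, 0 ≤ (q.1.1 - q.2.1) * (q.1.2 - q.2.2))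
    (hμd : ∀ᵐ p ∂μ.prod μ, p.1 - p.2 ≠ 0)
    (hνd : ∀ᵐ p ∂ν.prod ν, p.1 - p.2 = 0 → 1 / 2 < s)
    (hνi : Integrable (fun p : ℝ × ℝ => kernel s (p.1 - p.2)) (ν.prod ν))
    (hs0 : 0 < s) (hs1 : s ≤ 1) {ε : ℝ} (hε : 0 < ε) (hε1 : ε ≤ 1) :
    (∫ p : ℝ × ℝ, regKernel s ε (p.1 - p.2) ∂μ.prod μ) +
        2 * ∫ p, (∫ y, regSlope s ε (p.1 - y) ∂μ) * (p.2 - p.1) ∂π ≤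
      ∫ p : ℝ × ℝ, kernel s (p.1 - p.2) ∂ν.prod ν := by
  have hv : Integrable (fun p : ℝ × ℝ => p.2 - p.1) π :=
    integrable_of_integrable_sq (by fun_prop) (integrable_sq_coupling hfst hsnd hμ hν).2.2
  obtain ⟨i1, e1⟩ := integral_regSlope_mul_sub hfst hs0 hs1 hε hv
  have hmr := measurable_regKernel_sub hs0 hs1 hε
  have i2 := (integrable_prod_comp hmr hfst).2
    (integrable_regKernel_comp (integrable_fst_sub_snd hμ) hs0 hs1 hε)
  have i3 := (integrable_prod_comp (measurable_kernel_sub s) hsnd).2 hνi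
  rw [← e1, ← integral_prod_comp hmr hfst, ← integral_prod_comp (measurable_kernel_sub s) hsnd,
    ← integral_add i2 i1]
  refine integral_mono_ae (i2.add i1) i3 ?_
  filter_upwards [hmono, (hfst.prod hfst).quasiMeasurePreserving.ae hμd,
    (hsnd.prod hsnd).quasiMeasurePreserving.ae hνd] with q h1 h2 h3
  simp only [Prod.map_fst, Prod.map_snd] at h2 h3
  refine le_trans ?_ (regKernel_le_kernel hs0 hs1 hε hε1 h3)
  refine le_trans (le_of_eq ?_) (regKernel_tangent_le hs0 hs1 hε h2 h1)
  ring

/-- The first-order convexity inequality for the energy along a monotone coupling. -/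
lemma first_order_le_realEnergy {lam : ℝ} (hfst : MeasurePreserving Prod.fst π μ)
    (hsnd : MeasurePreserving Prod.snd π ν) (hμ : μ ∈ P2) (hν : ν ∈ P2)
    (hmono : ∀ᵐ q ∂π.prod π, 0 ≤ (q.1.1 - q.2.1) * (q.1.2 - q.2.2))
    (hμd : ∀ᵐ p ∂μ.prod μ, p.1 - p.2 ≠ 0)
    (hμi : Integrable (fun p : ℝ × ℝ => kernel s (p.1 - p.2)) (μ.prod μ))
    (hνd : ∀ᵐ p ∂ν.prod ν, p.1 - p.2 = 0 → 1 / 2 < s)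
    (hνi : Integrable (fun p : ℝ × ℝ => kernel s (p.1 - p.2)) (ν.prod ν))
    (hs0 : 0 < s) (hs1 : s ≤ 1) {g : ℝ → ℝ} (hgm : Measurable g) {B : ℝ} (hB : ∀ x, |g x| ≤ B)
    {u η : ℕ → ℝ} (hu0 : ∀ n, 0 < u n) (hu1 : ∀ n, u n ≤ 1) (hu : Tendsto u atTop (𝓝 0))
    (hη : Tendsto η atTop (𝓝 0))
    (hg : ∀ n x, |(∫ y, regSlope s (u n) (x - y) ∂μ) - g x| ≤ η n) :
    realEnergy s lam μ + (∫ p, (g p.1 + lam * p.1) * (p.2 - p.1) ∂π) +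
      lam / 2 * ∫ p, (p.2 - p.1) ^ 2 ∂π ≤ realEnergy s lam ν := by
  obtain ⟨j1, j2, j3⟩ := integrable_sq_coupling hfst hsnd hμ hν
  have hv : Integrable (fun p : ℝ × ℝ => p.2 - p.1) π :=
    integrable_of_integrable_sq (by fun_prop) j3
  have ig : Integrable (fun p : ℝ × ℝ => g p.1 * (p.2 - p.1)) π :=
    hv.bdd_mul (hgm.comp measurable_fst).aestronglyMeasurable
      (Eventually.of_forall fun p => hB p.1)
  -- letting the regularisation parameter tend to zero
  have key : (∫ p : ℝ × ℝ, kernel s (p.1 - p.2) ∂μ.prod μ) +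
      2 * ∫ p, g p.1 * (p.2 - p.1) ∂π ≤ ∫ p : ℝ × ℝ, kernel s (p.1 - p.2) ∂ν.prod ν := by
    have t1 := tendsto_integral_regKernel hs0 hs1 (integrable_fst_sub_snd hμ) hμd hμi hu0 hu1 hu
    have t2 : Tendsto (fun n => ∫ p, (∫ y, regSlope s (u n) (p.1 - y) ∂μ) * (p.2 - p.1) ∂π) atTop
        (𝓝 (∫ p, g p.1 * (p.2 - p.1) ∂π)) := by
      rw [tendsto_iff_norm_sub_tendsto_zero]
      refine squeeze_zero (fun n => norm_nonneg _) (fun n => ?_)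
        (by simpa using hη.mul_const (∫ p : ℝ × ℝ, |p.2 - p.1| ∂π))
      have i1 : Integrable (fun p : ℝ × ℝ =>
          (∫ y, regSlope s (u n) (p.1 - y) ∂μ) * (p.2 - p.1)) π :=
        hv.bdd_mul ((stronglyMeasurable_integral_regSlope s (u n) μ).comp_measurable
          measurable_fst).aestronglyMeasurable
          (Eventually.of_forall fun p => abs_integral_regSlope_le hs0 hs1 (hu0 n) p.1)
      rw [← integral_sub i1 ig, ← integral_const_mul]
      refine norm_integral_le_of_norm_le (hv.abs.const_mul _) (Eventually.of_forall fun p => ?_)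
      rw [← sub_mul, Real.norm_eq_abs, abs_mul]
      exact mul_le_mul_of_nonneg_right (hg n p.1) (abs_nonneg _)
    exact le_of_tendsto (t1.add (t2.const_mul 2)) (Eventually.of_forall fun n =>
      interaction_regKernel_le hfst hsnd hμ hν hmono hμd hνd hνi hs0 hs1 (hu0 n) (hu1 n))
  have e1 : ∫ x, x ^ 2 ∂μ = ∫ p, p.1 ^ 2 ∂π := by
    rw [← hfst.map_eq, integral_map measurable_fst.aemeasurable (by fun_prop)]
  have e2 : ∫ x, x ^ 2 ∂ν = ∫ p, p.2 ^ 2 ∂π := by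
    rw [← hsnd.map_eq, integral_map measurable_snd.aemeasurable (by fun_prop)]
  have e3 : ∀ p : ℝ × ℝ, (g p.1 + lam * p.1) * (p.2 - p.1) =
      g p.1 * (p.2 - p.1) + lam / 2 * (p.2 ^ 2 - p.1 ^ 2 - (p.2 - p.1) ^ 2) := fun p => by ring
  have e4 : ∫ p, (g p.1 + lam * p.1) * (p.2 - p.1) ∂π = (∫ p, g p.1 * (p.2 - p.1) ∂π) +
      lam / 2 * ((∫ p, p.2 ^ 2 ∂π) - (∫ p, p.1 ^ 2 ∂π) - ∫ p, (p.2 - p.1) ^ 2 ∂π) := by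
    simp only [e3]
    have j21 : Integrable (fun p : ℝ × ℝ => p.2 ^ 2 - p.1 ^ 2) π := j2.sub j1
    have j213 : Integrable (fun p : ℝ × ℝ => p.2 ^ 2 - p.1 ^ 2 - (p.2 - p.1) ^ 2) π := j21.sub j3
    rw [integral_add ig (j213.const_mul _), integral_const_mul, integral_sub j21 j3,
      integral_sub j2 j1]
  rw [realEnergy, realEnergy, e4, e1, e2]
  linarith

/-- Convexity of the energy along the displacement interpolation of a monotone coupling. -/
lemma realEnergy_interpolation_le (lam : ℝ) (hfst : MeasurePreserving Prod.fst π μ)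
    (hsnd : MeasurePreserving Prod.snd π ν) (hμ : μ ∈ P2) (hν : ν ∈ P2)
    (hmono : ∀ᵐ q ∂π.prod π, 0 ≤ (q.1.1 - q.2.1) * (q.1.2 - q.2.2))
    (hμd : ∀ᵐ p ∂μ.prod μ, p.1 - p.2 ≠ 0)
    (hμi : Integrable (fun p : ℝ × ℝ => kernel s (p.1 - p.2)) (μ.prod μ))
    (hνd : ∀ᵐ p ∂ν.prod ν, p.1 - p.2 = 0 → 1 / 2 < s)
    (hνi : Integrable (fun p : ℝ × ℝ => kernel s (p.1 - p.2)) (ν.prod ν))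
    (hs0 : 0 < s) (hs1 : s ≤ 1) {t : ℝ} (ht0 : 0 < t) (ht1 : t ≤ 1) :
    ∃ m ∈ P2, energy s lam m ≤ (((1 - t) * realEnergy s lam ν + t * realEnergy s lam μ -
      lam / 2 * (t * (1 - t)) * ∫ p, (p.2 - p.1) ^ 2 ∂π : ℝ) : EReal) := by
  obtain ⟨j1, j2, j3⟩ := integrable_sq_coupling hfst hsnd hμ hν
  set T : ℝ × ℝ → ℝ := fun p => (1 - t) * p.2 + t * p.1 with hTdef
  have hTm : Measurable T := by fun_prop
  have hT : MeasurePreserving T π (π.map T) := ⟨hTm, rfl⟩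
  have hprob : IsProbabilityMeasure (π.map T) := Measure.isProbabilityMeasure_map hTm.aemeasurable
  have eT : ∀ p, T p ^ 2 = (1 - t) * p.2 ^ 2 + t * p.1 ^ 2 - t * (1 - t) * (p.2 - p.1) ^ 2 :=
    fun p => by rw [hTdef]; ring
  have iT : Integrable (fun p => T p ^ 2) π := by
    simp only [eT]
    exact ((j2.const_mul _).add (j1.const_mul _)).sub (j3.const_mul _)
  have iT' : Integrable (fun x => x ^ 2) (π.map T) := (hT.integrable_comp (by fun_prop)).1 iT
  have hmem : π.map T ∈ P2 := by
    refine ⟨hprob, ?_⟩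
    rw [← hasFiniteIntegral_iff_ofReal (Eventually.of_forall fun x => sq_nonneg x)]
    exact iT'.2
  have hT0 : ∀ᵐ q ∂π.prod π, T q.1 - T q.2 ≠ 0 ∧
      kernel s (T q.1 - T q.2) ≤ (1 - t) * kernel s (q.1.2 - q.2.2) +
        t * kernel s (q.1.1 - q.2.1) := by
    filter_upwards [hmono, (hfst.prod hfst).quasiMeasurePreserving.ae hμd,
      (hsnd.prod hsnd).quasiMeasurePreserving.ae hνd] with q h1 h2 h3
    simp only [Prod.map_fst, Prod.map_snd] at h2 h3
    have e : T q.1 - T q.2 = (1 - t) * (q.1.2 - q.2.2) + t * (q.1.1 - q.2.1) := by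
      rw [hTdef]; ring
    refine ⟨fun h0 => ?_, e ▸ kernel_convex_comb_le hs0 hs1 h2 h3 h1 ht0 ht1⟩
    have h4 : 0 < t * ((q.1.1 - q.2.1) * (q.1.1 - q.2.1)) := mul_pos ht0 (mul_self_pos.2 h2)
    have h5 : 0 ≤ (1 - t) * ((q.1.1 - q.2.1) * (q.1.2 - q.2.2)) :=
      mul_nonneg (by linarith) h1
    have h6 : (T q.1 - T q.2) * (q.1.1 - q.2.1) = (1 - t) * ((q.1.1 - q.2.1) * (q.1.2 - q.2.2)) +
      t * ((q.1.1 - q.2.1) * (q.1.1 - q.2.1)) := by rw [e]; ring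
    rw [h0, zero_mul] at h6
    linarith
  have k1 := (integrable_prod_comp (measurable_kernel_sub s) hfst).2 hμi
  have k2 := (integrable_prod_comp (measurable_kernel_sub s) hsnd).2 hνi
  have kT : Integrable (fun q : (ℝ × ℝ) × (ℝ × ℝ) => kernel s (T q.1 - T q.2)) (π.prod π) := by
    refine integrable_of_le_of_le
      ((measurable_kernel s).comp (by fun_prop)).aestronglyMeasurable
      (g₁ := fun q => regKernel s 1 (T q.1 - T q.2)) ?_ (hT0.mono fun q hq => hq.2)
      ((integrable_prod_comp (measurable_regKernel_sub hs0 hs1 one_pos) hT).2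
        (integrable_regKernel_comp (integrable_fst_sub_snd hmem) hs0 hs1 one_pos))
      ((k2.const_mul _).add (k1.const_mul _))
    filter_upwards [hT0] with q hq
    exact regKernel_le_kernel hs0 hs1 one_pos le_rfl fun h => absurd h hq.1
  have kT' := (integrable_prod_comp (measurable_kernel_sub s) hT).1 kT
  have hTd : ∀ᵐ p ∂(π.map T).prod (π.map T), p.1 - p.2 = 0 → 1 / 2 < s := by
    rw [← (hT.prod hT).map_eq, ae_map_iff (hT.prod hT).aemeasurable]
    · filter_upwards [hT0] with q hq h
      exact absurd h hq.1
    · have : {p : ℝ × ℝ | p.1 - p.2 = 0 → 1 / 2 < s} =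
          {p : ℝ × ℝ | p.1 - p.2 = 0}ᶜ ∪ {_p | 1 / 2 < s} := by
        ext p; simp [imp_iff_not_or]
      rw [this]
      exact (measurableSet_eq_fun (by fun_prop) (by fun_prop)).compl.union (MeasurableSet.const _)
  refine ⟨π.map T, hmem, ?_⟩
  rw [energy_eq_coe hTd kT', EReal.coe_le_coe_iff]
  have e1 : ∫ x, x ^ 2 ∂μ = ∫ p, p.1 ^ 2 ∂π := by
    rw [← hfst.map_eq, integral_map measurable_fst.aemeasurable (by fun_prop)]
  have e2 : ∫ x, x ^ 2 ∂ν = ∫ p, p.2 ^ 2 ∂π := by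
    rw [← hsnd.map_eq, integral_map measurable_snd.aemeasurable (by fun_prop)]
  have e3 : ∫ x, x ^ 2 ∂π.map T = (1 - t) * (∫ p, p.2 ^ 2 ∂π) + t * (∫ p, p.1 ^ 2 ∂π) -
      t * (1 - t) * ∫ p, (p.2 - p.1) ^ 2 ∂π := by
    rw [integral_map hTm.aemeasurable (by fun_prop)]
    simp only [eT]
    have j21 : Integrable (fun p : ℝ × ℝ => (1 - t) * p.2 ^ 2 + t * p.1 ^ 2) π :=
      (j2.const_mul _).add (j1.const_mul _)
    rw [integral_sub j21 (j3.const_mul _),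
      integral_add (j2.const_mul _) (j1.const_mul _), integral_const_mul, integral_const_mul,
      integral_const_mul]
  have e4 : ∫ p : ℝ × ℝ, kernel s (p.1 - p.2) ∂(π.map T).prod (π.map T) ≤
      (1 - t) * (∫ p : ℝ × ℝ, kernel s (p.1 - p.2) ∂ν.prod ν) +
        t * ∫ p : ℝ × ℝ, kernel s (p.1 - p.2) ∂μ.prod μ := by
    rw [← integral_prod_comp (measurable_kernel_sub s) hT,
      ← integral_prod_comp (measurable_kernel_sub s) hfst,
      ← integral_prod_comp (measurable_kernel_sub s) hsnd, ← integral_const_mul,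
      ← integral_const_mul, ← integral_add (k2.const_mul _) (k1.const_mul _)]
    exact integral_mono_ae kT ((k2.const_mul _).add (k1.const_mul _)) (hT0.mono fun q hq => hq.2)
  rw [e3, realEnergy, realEnergy, e1, e2]
  linarith

end Coupling

lemma abs_integral_mul_le_sqrt {Ω : Type*} [MeasurableSpace Ω] {P : Measure Ω} {f g : Ω → ℝ}
    (hfm : AEStronglyMeasurable f P) (hgm : AEStronglyMeasurable g P)
    (hf : Integrable (fun ω => f ω ^ 2) P) (hg : Integrable (fun ω => g ω ^ 2) P) :
    |∫ ω, f ω * g ω ∂P| ≤ √(∫ ω, f ω ^ 2 ∂P) * √(∫ ω, g ω ^ 2 ∂P) := by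
  have hf2 : MemLp f (ENNReal.ofReal 2) P := by
    simpa using (memLp_two_iff_integrable_sq hfm).2 hf
  have hg2 : MemLp g (ENNReal.ofReal 2) P := by
    simpa using (memLp_two_iff_integrable_sq hgm).2 hg
  have h := integral_mul_norm_le_Lp_mul_Lq Real.HolderConjugate.two_two hf2 hg2
  simp only [Real.norm_eq_abs, Real.rpow_two, sq_abs, ← Real.sqrt_eq_rpow, ← abs_mul] at h
  exact abs_integral_le_integral_abs.trans h

/-! ### The functional inequalities -/

lemma measurable_potentialSlope (s : ℝ) {ρ : ℝ → ℝ} (hm : Measurable ρ) :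
    Measurable (potentialSlope s ρ) := by
  have h : StronglyMeasurable fun x => ∫ z, regSlope s 0 z * (ρ (x - z) - ρ (x + z)) :=
    StronglyMeasurable.integral_prod_right
      (f := fun x z => regSlope s 0 z * (ρ (x - z) - ρ (x + z)))
      (((measurable_regSlope s 0).comp measurable_snd).mul (by fun_prop)).stronglyMeasurable
  exact h.measurable.const_mul _

/-- The dissipation is the squared `L²(ρ)` norm of the derivative of the first variation. -/
lemma dissipation_eq_ofReal {s lam : ℝ} {ρ g : ℝ → ℝ} (hm : Measurable ρ) (h0 : ∀ x, 0 ≤ ρ x)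
    (hg : ∀ x, HasDerivAt (firstVariation s lam ρ) (g x) x)
    (hi : Integrable (fun x => g x ^ 2) (law ρ)) :
    dissipation s lam ρ = ENNReal.ofReal (∫ x, g x ^ 2 ∂law ρ) := by
  rw [integral_law hm h0, ofReal_integral_eq_lintegral_ofReal ((integrable_law_iff hm h0 _).1 hi)
    (Eventually.of_forall fun x => mul_nonneg (sq_nonneg _) (h0 x)), dissipation]
  simp only [(hg _).deriv, sq_abs, mul_comm]

/-- The optimal monotone coupling computes the Wasserstein distance as an `L²` norm. -/
lemma W2_eq_ofReal {μ ν : Measure ℝ} {π : Measure (ℝ × ℝ)}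
    (h : W2 μ ν = (∫⁻ p, ENNReal.ofReal (|p.1 - p.2| ^ 2) ∂π) ^ (1 / 2 : ℝ))
    (hi : Integrable (fun p => (p.2 - p.1) ^ 2) π) :
    W2 μ ν = ENNReal.ofReal √(∫ p, (p.2 - p.1) ^ 2 ∂π) := by
  rw [h, Real.sqrt_eq_rpow, ← ENNReal.ofReal_rpow_of_nonneg
    (integral_nonneg fun _ => sq_nonneg _) (by norm_num),
    ofReal_integral_eq_lintegral_ofReal hi (Eventually.of_forall fun _ => sq_nonneg _)]
  simp only [sq_abs, sub_sq_comm]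

end FracHWI

open Set Filter Topology FracHWI in
theorem mainTheorem2 (s lam : ℝ) (hs0 : 0 < s) (hs1 : s ≤ 1)
    (α : ℝ≥0) (hα : max (1 - 2 * s) 0 < (α : ℝ)) (hα1 : α ≤ 1)
    (ρ : ℝ → ℝ) (hρ_nonneg : ∀ x, 0 ≤ ρ x)
    (hρ_L1 : Integrable ρ) (hρ_Linf : MemLp ρ ∞ volume) (hρ_holder : ∃ C : ℝ≥0, HolderWith C α ρ)
    (hρ_mass : ∫ x, ρ x = 1) (hρ_moment : Integrable fun x => x ^ 2 * ρ x)
    (ρinf : Measure ℝ) (hmin : FracHWI.IsEnergyMinimizer s lam ρinf) :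
    -- all the quantities below are well defined and finite
    ((∀ x, Integrable fun y => FracHWI.kernel s (x - y) * ρ y) ∧
      Differentiable ℝ (FracHWI.firstVariation s lam ρ) ∧
      FracHWI.dissipation s lam ρ ≠ ∞ ∧
      FracHWI.W2 (FracHWI.law ρ) ρinf ≠ ∞ ∧
      (FracHWI.energy s lam (FracHWI.law ρ) ≠ ⊤ ∧ FracHWI.energy s lam (FracHWI.law ρ) ≠ ⊥) ∧
      (FracHWI.energy s lam ρinf ≠ ⊤ ∧ FracHWI.energy s lam ρinf ≠ ⊥)) ∧
    -- HWI inequality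
    (FracHWI.energy s lam (FracHWI.law ρ)).toReal - (FracHWI.energy s lam ρinf).toReal ≤
      √(FracHWI.dissipation s lam ρ).toReal * (FracHWI.W2 (FracHWI.law ρ) ρinf).toReal
        - lam / 2 * (FracHWI.W2 (FracHWI.law ρ) ρinf).toReal ^ 2 ∧
    (0 < lam →
      -- Log-Sobolev inequality
      (FracHWI.energy s lam (FracHWI.law ρ)).toReal - (FracHWI.energy s lam ρinf).toReal ≤
        1 / (2 * lam) * (FracHWI.dissipation s lam ρ).toReal ∧
      -- Talagrand inequality
      (FracHWI.W2 (FracHWI.law ρ) ρinf).toReal ≤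
        √(2 / lam * ((FracHWI.energy s lam (FracHWI.law ρ)).toReal
          - (FracHWI.energy s lam ρinf).toReal))) := by
  obtain ⟨C, hC⟩ := hρ_holder
  obtain ⟨hα', hα0⟩ := max_lt_iff.1 hα
  have hm : Measurable ρ := (hC.uniformContinuous (NNReal.coe_pos.1 hα0)).continuous.measurable
  obtain ⟨M, hM⟩ := exists_law_le hρ_Linf
  have hprob : IsProbabilityMeasure (law ρ) := isProbabilityMeasure_law hρ_L1 hρ_nonneg hρ_mass
  have hμ : law ρ ∈ P2 := law_mem_P2 hm hρ_L1 hρ_nonneg hρ_mass hρ_moment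
  obtain ⟨hν, hminOn⟩ := hmin
  have hprob' : IsProbabilityMeasure ρinf := hν.1
  -- finiteness of the energies
  have hμd : ∀ᵐ p ∂(law ρ).prod (law ρ), p.1 - p.2 ≠ 0 := ae_prod_law_sub_ne_zero
  have hμi := integrable_kernel_prod_law hs0 hs1 hμ hM
  have hEμ : energy s lam (law ρ) = (realEnergy s lam (law ρ) : EReal) :=
    energy_eq_coe (hμd.mono fun p hp h => absurd h hp) hμi
  have hEν_le : energy s lam ρinf ≤ energy s lam (law ρ) := hminOn hμ
  obtain ⟨hνd, hνi⟩ := of_interaction_ne_top hs0 hs1 hν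
    (interaction_ne_top_of_energy_ne_top (s := s) (lam := lam)
      (ne_top_of_le_ne_top (hEμ ▸ EReal.coe_ne_top _) hEν_le))
  have hEν : energy s lam ρinf = (realEnergy s lam ρinf : EReal) := energy_eq_coe hνd hνi
  -- the optimal coupling
  obtain ⟨π, hπ, hπ1, hπ2, hmono, hW⟩ := exists_monotone_optimal_coupling (law ρ) ρinf
  have hfst : MeasurePreserving Prod.fst π (law ρ) := ⟨measurable_fst, hπ1⟩
  have hsnd : MeasurePreserving Prod.snd π ρinf := ⟨measurable_snd, hπ2⟩
  obtain ⟨j1, j2, j3⟩ := integrable_sq_coupling hfst hsnd hμ hν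
  have hW' := W2_eq_ofReal hW j3
  set D := ∫ p, (p.2 - p.1) ^ 2 ∂π with hD
  have hD0 : 0 ≤ D := integral_nonneg fun _ => sq_nonneg _
  have hWr : (W2 (law ρ) ρinf).toReal = √D := by
    rw [hW', ENNReal.toReal_ofReal (Real.sqrt_nonneg _)]
  -- the derivative of the first variation
  have hgm := measurable_potentialSlope s hm
  obtain ⟨B, hB⟩ := exists_abs_potentialSlope_le hs0 hs1 hm hρ_nonneg hρ_L1 hα' hC
  have hderiv : ∀ x, HasDerivAt (firstVariation s lam ρ) (potentialSlope s ρ x + lam * x) x := by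
    intro x
    have h1 := hasDerivAt_rieszPotential hs0 hs1 hm hρ_nonneg hρ_L1 hμ hM hα' hC x
    have h2 : HasDerivAt (fun x : ℝ => lam / 2 * x ^ 2) (lam * x) x := by
      refine ((hasDerivAt_pow 2 x).const_mul (lam / 2)).congr_deriv ?_
      norm_num
      ring
    exact h1.add h2
  have hslope : Integrable (fun x => (potentialSlope s ρ x + lam * x) ^ 2) (law ρ) := by
    refine ((integrable_const (2 * B ^ 2)).add
      ((integrable_sq_of_mem_P2 hμ).const_mul (2 * lam ^ 2))).mono'
      ((hgm.add (measurable_id.const_mul lam)).pow_const 2).aestronglyMeasurable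
      (Eventually.of_forall fun x => ?_)
    rw [Real.norm_of_nonneg (sq_nonneg _), Pi.add_apply]
    have := sq_le_sq' (abs_le.1 (hB x)).1 (abs_le.1 (hB x)).2
    nlinarith [sq_nonneg (potentialSlope s ρ x - lam * x)]
  have hI := dissipation_eq_ofReal hm hρ_nonneg hderiv hslope
  set J := ∫ x, (potentialSlope s ρ x + lam * x) ^ 2 ∂law ρ with hJ
  have hJ0 : 0 ≤ J := integral_nonneg fun _ => sq_nonneg _
  have hIr : (dissipation s lam ρ).toReal = J := by rw [hI, ENNReal.toReal_ofReal hJ0]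
  -- the first-order convexity inequality, combined with the Cauchy-Schwarz inequality
  have hHWI : realEnergy s lam (law ρ) - realEnergy s lam ρinf ≤ √J * √D - lam / 2 * D := by
    have hu1 : ∀ n : ℕ, 1 / ((n : ℝ) + 1) ≤ 1 := fun n =>
      div_le_one_of_le₀ (by linarith [n.cast_nonneg (α := ℝ)]) (by positivity)
    have hfirst := first_order_le_realEnergy (lam := lam) hfst hsnd hμ hν hmono hμd hμi hνd hνi
      hs0 hs1 hgm hB (u := fun n => 1 / ((n : ℝ) + 1)) (fun n => Nat.one_div_pos_of_nat) hu1
      tendsto_one_div_add_atTop_nhds_zero_nat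
      (tendsto_slopeError hs0 hs1 C.2 hα' hu1 tendsto_one_div_add_atTop_nhds_zero_nat)
      fun n x => abs_integral_regSlope_sub_le hs0 hs1 hm hρ_nonneg hρ_L1 hα' hC
        Nat.one_div_pos_of_nat (hu1 n) x
    have hmeas : Measurable fun x => potentialSlope s ρ x + lam * x :=
      hgm.add (measurable_id.const_mul lam)
    have hCS := abs_integral_mul_le_sqrt (P := π)
      (f := fun p => potentialSlope s ρ p.1 + lam * p.1) (g := fun p => p.2 - p.1)
      (hmeas.comp measurable_fst).aestronglyMeasurable (by fun_prop)
      ((hfst.integrable_comp (hmeas.pow_const 2).aestronglyMeasurable).2 hslope) j3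
    have hJπ : J = ∫ p, (potentialSlope s ρ p.1 + lam * p.1) ^ 2 ∂π := by
      rw [hJ, ← hfst.map_eq, integral_map measurable_fst.aemeasurable
        (hmeas.pow_const 2).aestronglyMeasurable]
    rw [← hJπ, ← hD] at hCS
    linarith [neg_abs_le (∫ p, (potentialSlope s ρ p.1 + lam * p.1) * (p.2 - p.1) ∂π)]
  refine ⟨⟨fun x => (integrable_law_iff hm hρ_nonneg _).1 (integrable_kernel_law hs0 hs1 hμ hM x),
    fun x => (hderiv x).differentiableAt, hI ▸ ENNReal.ofReal_ne_top, hW' ▸ ENNReal.ofReal_ne_top,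
    ⟨hEμ ▸ EReal.coe_ne_top _, hEμ ▸ EReal.coe_ne_bot _⟩,
    ⟨hEν ▸ EReal.coe_ne_top _, hEν ▸ EReal.coe_ne_bot _⟩⟩, ?_, fun hlam => ⟨?_, ?_⟩⟩
  · rw [hEμ, hEν, hIr, hWr, EReal.toReal_coe, EReal.toReal_coe, Real.sq_sqrt hD0]
    exact hHWI
  · rw [hEμ, hEν, hIr, EReal.toReal_coe, EReal.toReal_coe]
    -- maximise `√J w - lam / 2 w²` over `w`
    have hsq : √J * √D - lam / 2 * D ≤ 1 / (2 * lam) * J := by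
      have h1 : 1 / (2 * lam) * J - (√J * √D - lam / 2 * D) =
          1 / (2 * lam) * (√J - lam * √D) ^ 2 := by
        rw [sub_sq, mul_pow, Real.sq_sqrt hJ0, Real.sq_sqrt hD0]
        field_simp
        ring
      have h2 : 0 ≤ 1 / (2 * lam) * (√J - lam * √D) ^ 2 := by positivity
      linarith
    exact hHWI.trans hsq
  · rw [hEμ, hEν, hWr, EReal.toReal_coe, EReal.toReal_coe]
    refine Real.sqrt_le_sqrt ?_
    -- compare the minimiser with the interpolation at time `t`, divide by `t`, and let `t → 0`
    have hstep : ∀ t : ℝ, 0 < t → t ≤ 1 →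
        lam / 2 * (1 - t) * D ≤ realEnergy s lam (law ρ) - realEnergy s lam ρinf := by
      intro t ht0 ht1
      obtain ⟨m, hmP, hle⟩ := realEnergy_interpolation_le lam hfst hsnd hμ hν hmono hμd hμi hνd hνi
        hs0 hs1 ht0 ht1
      have h1 : energy s lam ρinf ≤ energy s lam m := hminOn hmP
      have h2 := h1.trans hle
      rw [hEν, EReal.coe_le_coe_iff, ← hD] at h2
      refine le_of_mul_le_mul_left ?_ ht0
      linarith
    have hlim : Tendsto (fun t : ℝ => lam / 2 * (1 - t) * D) (𝓝[>] 0)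
        (𝓝 (lam / 2 * (1 - 0) * D)) :=
      (Continuous.tendsto (by fun_prop) 0).mono_left nhdsWithin_le_nhds
    have hfin : lam / 2 * (1 - 0) * D ≤ realEnergy s lam (law ρ) - realEnergy s lam ρinf := by
      refine le_of_tendsto hlim ?_
      filter_upwards [Ioc_mem_nhdsGT (zero_lt_one' ℝ)] with t ht using hstep t ht.1 ht.2
    calc D = 2 / lam * (lam / 2 * (1 - 0) * D) := by field_simp; ring
      _ ≤ _ := mul_le_mul_of_nonneg_left hfin (by positivity)
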